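/- Let $f \colon \widehat{\mathbb{C}} \to \widehat{\mathbb{C}}$ be a rational map of degree $2$ of the Riemann sphere. A point $z_0 \in \widehat{\mathbb{C}}$ is periodic for $f$ if $f^{\circ n}(z_0) = z_0$ for some $n \geq 1$; the least such $n$ is its period, and the multiplier of $f$ at $z_0$ is then the unique eigenvalue of the differential of $f^{\circ n}$ at $z_0$. Assume that the multiplier of $f$ at every periodic point is an integer (an element of $\mathbb{Z}$). Then $f$ is a power map or a Chebyshev map. Here a rational map of degree $d \geq 2$ is called a power map if it is conjugate, by a Möbius transformation, to $z \mapsto z^{d}$ or $z \mapsto z^{-d}$, and a Chebyshev map if it is conjugate, by a Möbius transformation, to $T_d$ or $-T_d$, where $T_d \in \mathbb{C}[z]$ is the unique polynomial such that $T_d(z + z^{-1}) = z^{d} + z^{-d}$. -/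

import Mathlib

open Polynomial OnePoint
open scoped MatrixGroups

noncomputable section

/-- The map `z ↦ p(z) / q(z)` of the Riemann sphere `OnePoint ℂ = ℂ ∪ {∞}` to itself,
for coprime `p` and `q`. With `d = max (deg p) (deg q)`, its value at `∞` is the quotient of the
coefficients of degree `d` (and `∞` if that of `q` vanishes). -/
def ratMap (p q : ℂ[X]) : OnePoint ℂ → OnePoint ℂ := fun x =>
  x.elim
    (if q.coeff (max p.natDegree q.natDegree) = 0 then ∞
      else ((p.coeff (max p.natDegree q.natDegree) /
        q.coeff (max p.natDegree q.natDegree) : ℂ) : OnePoint ℂ))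
    (fun z => if q.eval z = 0 then ∞ else ((p.eval z / q.eval z : ℂ) : OnePoint ℂ))

/-- `f` is a rational map of degree `d` of the Riemann sphere. -/
def IsRationalMap (d : ℕ) (f : OnePoint ℂ → OnePoint ℂ) : Prop :=
  ∃ p q : ℂ[X], IsCoprime p q ∧ max p.natDegree q.natDegree = d ∧ f = ratMap p q

/-- The involution `z ↦ 1 / z` of the Riemann sphere, exchanging `0` and `∞`. -/
def sphereInv : OnePoint ℂ → OnePoint ℂ := fun x =>
  x.elim ((0 : ℂ) : OnePoint ℂ) (fun z => if z = 0 then ∞ else ((z⁻¹ : ℂ) : OnePoint ℂ))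

/-- The affine coordinate on the finite part of the sphere (with an arbitrary value at `∞`). -/
def affineCoord : OnePoint ℂ → ℂ := fun x => x.elim 0 id

/-- The differential of `g` at its fixed point `x` is multiplication by `μ`. It is computed in the
chart `z` if `x` is finite, and in the chart `1 / z` if `x = ∞`. -/
def HasFixedPointMultiplier (g : OnePoint ℂ → OnePoint ℂ) (x : OnePoint ℂ) (μ : ℂ) : Prop :=
  x.elim
    (HasDerivAt (fun w : ℂ => affineCoord (sphereInv (g (sphereInv (w : OnePoint ℂ))))) μ 0)
    (fun z => HasDerivAt (fun w : ℂ => affineCoord (g (w : OnePoint ℂ))) μ z)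

/-- `μ` is the multiplier of `f` at the periodic point `x`: with `n` the (least) period of `x`,
it is the eigenvalue of the differential of the `n`th iterate of `f` at `x`. -/
def HasMultiplierAt (f : OnePoint ℂ → OnePoint ℂ) (x : OnePoint ℂ) (μ : ℂ) : Prop :=
  x ∈ Function.periodicPts f ∧ HasFixedPointMultiplier (f^[Function.minimalPeriod f x]) x μ

/-- The multipliers of `f` at all of its cycles are integers. -/
def HasOnlyIntegerMultipliers (f : OnePoint ℂ → OnePoint ℂ) : Prop :=
  ∀ (x : OnePoint ℂ) (μ : ℂ), HasMultiplierAt f x μ → ∃ m : ℤ, μ = (m : ℂ)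

/-- `f` and `g` are conjugate by a Möbius transformation. -/
def AreMoebiusConjugate (f g : OnePoint ℂ → OnePoint ℂ) : Prop :=
  ∃ φ : GL (Fin 2) ℂ, ∀ x : OnePoint ℂ, φ • f x = g (φ • x)

/-- Power maps: rational maps of some degree `d ≥ 2` conjugate to `z ↦ z ^ d` or `z ↦ z ^ (-d)`. -/
def IsPowerMap (f : OnePoint ℂ → OnePoint ℂ) : Prop :=
  ∃ d : ℕ, 2 ≤ d ∧ IsRationalMap d f ∧
    (AreMoebiusConjugate f (ratMap (X ^ d) 1) ∨ AreMoebiusConjugate f (ratMap 1 (X ^ d)))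

/-- Chebyshev maps: rational maps of some degree `d ≥ 2` conjugate to `T_d` or `-T_d`, where `T_d`
is the monic Chebyshev polynomial, which is `Polynomial.Chebyshev.C ℂ d` in Mathlib. -/
def IsChebyshevMap (f : OnePoint ℂ → OnePoint ℂ) : Prop :=
  ∃ d : ℕ, 2 ≤ d ∧ IsRationalMap d f ∧
    (AreMoebiusConjugate f (ratMap (Chebyshev.C ℂ d) 1) ∨
      AreMoebiusConjugate f (ratMap (-Chebyshev.C ℂ d) 1))

/-- The defining property `T_d (z + 1 / z) = z ^ d + 1 / z ^ d` of the polynomials used above. -/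
theorem chebyshevC_eval_add_inv (d : ℕ) (z : ℂ) (hz : z ≠ 0) :
    (Chebyshev.C ℂ d).eval (z + z⁻¹) = z ^ d + z⁻¹ ^ d := by
  rw [← dickson_one_one_eq_chebyshev_C]
  exact dickson_one_one_eval_add_inv z z⁻¹ (mul_inv_cancel₀ hz) d

end

/-!
If some fixed point has multiplier `0`, then `f` is conjugate to `z ^ 2 + c`. Writing `1 - n` for
the integer multiplier of a finite fixed point, `4 c = 1 - n ^ 2`. The multipliers of the two cycles
of length three are exchanged by `√(n ^ 2 - 8) ↦ -√(n ^ 2 - 8)`, so their integrality forces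
`n ^ 2 = 1` or `n ^ 2 = 9`, that is, `c = 0` or `c = -2`.

Otherwise, if no fixed point has multiplier `1`, there are three fixed points and their multipliers
satisfy `∑ 1 / (1 - μ) = 1`. If `-1` is not among them either, each integer `1 - μ` is negative or
at least `3`, so all three are equal to `3` and `f` is conjugate to `1 / z ^ 2`.

It remains to exclude the multipliers `1` and `-1`. The holomorphic fixed point formula above, for
`-1`, and cycles of length three, for `1`, leave only six maps up to conjugacy. Each of these has a
real cycle of length five, located by the intermediate value theorem, whose multiplier lies strictly
between two consecutive integers in absolute value.
-/

/-! ### Homogeneous coordinates on the projective line -/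

lemma eq_zero_of_det_ne_zero {R : Type*} [CommRing R] [NoZeroDivisors R] {A B C D x y : R}
    (hdet : A * D - B * C ≠ 0) (h₁ : A * x + B * y = 0) (h₂ : C * x + D * y = 0) :
    x = 0 ∧ y = 0 := by
  constructor <;> refine (mul_eq_zero.1 ?_).resolve_left hdet
  · linear_combination D * h₁ - B * h₂
  · linear_combination A * h₂ - C * h₁

section HomogeneousCoordinates

variable {K : Type*} [Field K] [DecidableEq K]

/-- The point of the projective line `OnePoint K` with homogeneous coordinates `[x : y]`
(the junk value `∞` is taken at `x = y = 0`). -/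
def homPt (x y : K) : OnePoint K := if y = 0 then ∞ else ((x / y : K) : OnePoint K)

lemma homPt_zero_right (x : K) : homPt x 0 = ∞ := by simp [homPt]

lemma homPt_of_ne {x y : K} (hy : y ≠ 0) : homPt x y = ((x / y : K) : OnePoint K) := by
  simp [homPt, hy]

lemma homPt_one_right (z : K) : homPt z 1 = (z : OnePoint K) := by simp [homPt]

lemma homPt_mul {k : K} (hk : k ≠ 0) (x y : K) : homPt (k * x) (k * y) = homPt x y := by
  by_cases hy : y = 0
  · simp [hy, homPt_zero_right]
  · rw [homPt_of_ne hy, homPt_of_ne (mul_ne_zero hk hy), mul_div_mul_left _ _ hk]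

lemma exists_eq_homPt (x : OnePoint K) : ∃ a b : K, (a ≠ 0 ∨ b ≠ 0) ∧ x = homPt a b := by
  induction x using OnePoint.rec with
  | infty => exact ⟨1, 0, by simp, (homPt_zero_right 1).symm⟩
  | coe z => exact ⟨z, 1, by simp, (homPt_one_right z).symm⟩

lemma smul_homPt (g : GL (Fin 2) K) {x y : K} (hxy : x ≠ 0 ∨ y ≠ 0) :
    g • homPt x y = homPt (g 0 0 * x + g 0 1 * y) (g 1 0 * x + g 1 1 * y) := by
  by_cases hy : y = 0
  · subst hy
    have hx : x ≠ 0 := by simpa using hxy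
    rw [homPt_zero_right, OnePoint.smul_infty_eq_ite, mul_zero, mul_zero, add_zero, add_zero,
      mul_comm _ x, mul_comm _ x, homPt_mul hx]
    rfl
  · have factor (u v : K) : u * x + v * y = y * (u * (x / y) + v) := by field_simp
    rw [homPt_of_ne hy, OnePoint.smul_some_eq_ite, factor, factor, homPt_mul hy]
    rfl

/-- The Möbius transformation `z ↦ (A z + B) / (C z + D)`. -/
def moebius {A B C D : K} (hdet : A * D - B * C ≠ 0) : GL (Fin 2) K :=
  Matrix.GeneralLinearGroup.mkOfDetNeZero !![A, B; C, D] (by rwa [Matrix.det_fin_two_of])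

lemma moebius_smul_homPt {A B C D : K} (hdet : A * D - B * C ≠ 0) {x y : K}
    (hxy : x ≠ 0 ∨ y ≠ 0) :
    moebius hdet • homPt x y = homPt (A * x + B * y) (C * x + D * y) := by
  rw [smul_homPt _ hxy]
  rfl

end HomogeneousCoordinates

/-! ### Derivatives of self-maps of the sphere -/

/-- The inverse of the standard chart around `x`, namely `z` if `x` is finite and `1 / z` if
`x = ∞`. -/
noncomputable def chartInv (x : OnePoint ℂ) (w : ℂ) : OnePoint ℂ :=
  x.elim (sphereInv (w : OnePoint ℂ)) (fun _ => (w : OnePoint ℂ))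

lemma sphereInv_coe (w : ℂ) : sphereInv (w : OnePoint ℂ) = homPt 1 w := by
  simp [sphereInv, homPt]

lemma sphereInv_involutive : Function.Involutive sphereInv := by
  intro x
  induction x using OnePoint.rec with
  | infty => simp [sphereInv]
  | coe z => by_cases hz : z = 0 <;> simp [hz, sphereInv]

lemma chartInv_infty (w : ℂ) : chartInv ∞ w = homPt 1 w := sphereInv_coe w

lemma chartInv_coe (z w : ℂ) : chartInv (z : OnePoint ℂ) w = (w : OnePoint ℂ) := rfl

lemma affineCoord_coe (z : ℂ) : affineCoord (z : OnePoint ℂ) = z := rfl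

lemma affineCoord_infty : affineCoord ∞ = 0 := rfl

lemma chartInv_affineCoord (x : OnePoint ℂ) : chartInv x (affineCoord x) = x := by
  induction x using OnePoint.rec with
  | infty => rw [chartInv_infty, affineCoord_infty, homPt_zero_right]
  | coe z => rfl

lemma chartInv_injective (x : OnePoint ℂ) : Function.Injective (chartInv x) := by
  induction x using OnePoint.rec with
  | infty => exact sphereInv_involutive.injective.comp OnePoint.coe_injective
  | coe => exact OnePoint.coe_injective

/-- The derivative of `f` at `x` is `m` in the standard charts around `x` and `f x`. Unlike
`HasFixedPointMultiplier`, this makes sense at any point, so that there is a chain rule. -/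
def HasSphereDeriv (f : OnePoint ℂ → OnePoint ℂ) (x : OnePoint ℂ) (m : ℂ) : Prop :=
  ∃ F : ℂ → ℂ, HasDerivAt F m (affineCoord x) ∧
    ∀ᶠ w in nhds (affineCoord x), f (chartInv x w) = chartInv (f x) (F w)

namespace HasSphereDeriv

variable {f g : OnePoint ℂ → OnePoint ℂ} {x : OnePoint ℂ} {m n : ℂ}

lemma unique (hm : HasSphereDeriv f x m) (hn : HasSphereDeriv f x n) : m = n := by
  obtain ⟨F, hF, hfF⟩ := hm
  obtain ⟨G, hG, hfG⟩ := hn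
  refine hF.unique (hG.congr_of_eventuallyEq ?_)
  filter_upwards [hfF, hfG] with w hFw hGw
  exact chartInv_injective _ (hFw.symm.trans hGw)

protected lemma id : HasSphereDeriv id x 1 := ⟨id, hasDerivAt_id _, by simp⟩

lemma comp (hg : HasSphereDeriv g (f x) n) (hf : HasSphereDeriv f x m) :
    HasSphereDeriv (g ∘ f) x (n * m) := by
  obtain ⟨F, hF, hfF⟩ := hf
  obtain ⟨G, hG, hgG⟩ := hg
  have hFx : affineCoord (f x) = F (affineCoord x) := by
    apply chartInv_injective (f x)
    rw [chartInv_affineCoord, ← hfF.self_of_nhds, chartInv_affineCoord]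
  rw [hFx] at hG hgG
  refine ⟨G ∘ F, hG.comp _ hF, ?_⟩
  filter_upwards [hfF, hF.continuousAt.eventually hgG] with w hFw hGw
  rw [Function.comp_apply, hFw, hGw, Function.comp_apply, Function.comp_apply]

lemma iterate {m : ℕ → ℂ} {n : ℕ} (h : ∀ i < n, HasSphereDeriv f (f^[i] x) (m i)) :
    HasSphereDeriv f^[n] x (∏ i ∈ Finset.range n, m i) := by
  induction n with
  | zero => simpa using HasSphereDeriv.id
  | succ n ih =>
    rw [Finset.prod_range_succ, mul_comm, Function.iterate_succ']
    exact (h n n.lt_succ_self).comp (ih fun i hi => h i (hi.trans n.lt_succ_self))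

lemma hasFixedPointMultiplier (h : HasSphereDeriv f x m) (hx : f x = x) :
    HasFixedPointMultiplier f x m := by
  obtain ⟨F, hF, hfF⟩ := h
  rw [hx] at hfF
  induction x using OnePoint.rec with
  | infty =>
    refine HasDerivAt.congr_of_eventuallyEq hF ?_
    filter_upwards [hfF] with w hw
    rw [sphereInv_coe, ← chartInv_infty, hw, chartInv_infty, ← sphereInv_coe,
      sphereInv_involutive, affineCoord_coe]
  | coe z =>
    refine HasDerivAt.congr_of_eventuallyEq hF ?_
    filter_upwards [hfF] with w hw
    rw [← chartInv_coe z, hw, chartInv_coe, affineCoord_coe]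

lemma of_coe {F : ℂ → ℂ} {z : ℂ} (hf : ∀ᶠ w : ℂ in nhds z, f w = F w) (hF : HasDerivAt F m z) :
    HasSphereDeriv f z m := by
  refine ⟨F, hF, ?_⟩
  rw [hf.self_of_nhds]
  exact hf

lemma of_homPt_of_ne {P Q : ℂ → ℂ} (hf : ∀ w, f (chartInv x w) = homPt (P w) (Q w))
    (hQ : Q (affineCoord x) ≠ 0) (hQc : ContinuousAt Q (affineCoord x))
    (hPQ : HasDerivAt (fun w => P w / Q w) m (affineCoord x)) : HasSphereDeriv f x m := by
  refine ⟨_, hPQ, ?_⟩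
  have hfx := hf (affineCoord x)
  rw [chartInv_affineCoord, homPt_of_ne hQ] at hfx
  filter_upwards [hQc.eventually_ne hQ] with w hw
  rw [hf, hfx, chartInv_coe, homPt_of_ne hw]

lemma of_homPt_of_eq_zero {P Q : ℂ → ℂ} (hf : ∀ w, f (chartInv x w) = homPt (P w) (Q w))
    (hQ : Q (affineCoord x) = 0) (hP : P (affineCoord x) ≠ 0)
    (hPc : ContinuousAt P (affineCoord x))
    (hQP : HasDerivAt (fun w => Q w / P w) m (affineCoord x)) : HasSphereDeriv f x m := by
  refine ⟨_, hQP, ?_⟩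
  have hfx := hf (affineCoord x)
  rw [chartInv_affineCoord, hQ, homPt_zero_right] at hfx
  filter_upwards [hPc.eventually_ne hP] with w hw
  rw [hf, hfx, chartInv_infty, ← homPt_mul hw 1, mul_one, mul_div_cancel₀ _ hw]

end HasSphereDeriv

lemma exists_hasSphereDeriv_of_homPt {f : OnePoint ℂ → OnePoint ℂ} {x : OnePoint ℂ} {P Q : ℂ → ℂ}
    (hf : ∀ w, f (chartInv x w) = homPt (P w) (Q w))
    (hne : P (affineCoord x) ≠ 0 ∨ Q (affineCoord x) ≠ 0)
    (hP : Differentiable ℂ P) (hQ : Differentiable ℂ Q) : ∃ m, HasSphereDeriv f x m := by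
  by_cases hQ₀ : Q (affineCoord x) = 0
  · have hP₀ : P (affineCoord x) ≠ 0 := hne.resolve_right (not_not_intro hQ₀)
    exact ⟨_, .of_homPt_of_eq_zero hf hQ₀ hP₀ hP.continuous.continuousAt
      ((hQ _).div (hP _) hP₀).hasDerivAt⟩
  · exact ⟨_, .of_homPt_of_ne hf hQ₀ hQ.continuous.continuousAt
      ((hP _).div (hQ _) hQ₀).hasDerivAt⟩

lemma exists_hasSphereDeriv_smul (φ : GL (Fin 2) ℂ) (x : OnePoint ℂ) :
    ∃ m, HasSphereDeriv (φ • ·) x m := by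
  have hdet : φ 0 0 * φ 1 1 - φ 0 1 * φ 1 0 ≠ 0 := by
    rw [← Matrix.det_fin_two]
    exact φ.det_ne_zero
  have hne {u v : ℂ} (huv : u ≠ 0 ∨ v ≠ 0) :
      φ 0 0 * u + φ 0 1 * v ≠ 0 ∨ φ 1 0 * u + φ 1 1 * v ≠ 0 := by
    contrapose! huv
    exact eq_zero_of_det_ne_zero hdet huv.1 huv.2
  induction x using OnePoint.rec with
  | infty =>
    exact exists_hasSphereDeriv_of_homPt (P := fun w => φ 0 0 * 1 + φ 0 1 * w)
      (Q := fun w => φ 1 0 * 1 + φ 1 1 * w)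
      (fun w => by rw [chartInv_infty, smul_homPt _ (by simp)]) (hne (by simp))
      (by fun_prop) (by fun_prop)
  | coe z =>
    exact exists_hasSphereDeriv_of_homPt (P := fun w => φ 0 0 * w + φ 0 1 * 1)
      (Q := fun w => φ 1 0 * w + φ 1 1 * 1)
      (fun w => by rw [chartInv_coe, ← homPt_one_right, smul_homPt _ (by simp)]) (hne (by simp))
      (by fun_prop) (by fun_prop)

/-! ### Multipliers -/

/-- The point `x` is fixed by `f`, with multiplier `m`. Applied to an iterate `f^[n]`, this also
covers points whose period is a proper divisor of `n`. -/
structure IsFixedPtWithMultiplier (f : OnePoint ℂ → OnePoint ℂ) (x : OnePoint ℂ) (m : ℂ) :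
    Prop where
  isFixedPt : f x = x
  hasSphereDeriv : HasSphereDeriv f x m

/-- For all `n ≤ N`, the multipliers of `f^[n]` at its fixed points are integers. -/
def HasIntegerMultipliersUpTo (N : ℕ) (f : OnePoint ℂ → OnePoint ℂ) : Prop :=
  ∀ n ≤ N, ∀ x m, IsFixedPtWithMultiplier f^[n] x m → ∃ k : ℤ, m = k

lemma hasIntegerMultipliersUpTo_of_minimalPeriod_le {f : OnePoint ℂ → OnePoint ℂ} {N : ℕ}
    (hd : ∀ x, ∃ m, HasSphereDeriv f x m)
    (hf : ∀ x μ, Function.minimalPeriod f x ≤ N → HasMultiplierAt f x μ → ∃ k : ℤ, μ = k) :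
    HasIntegerMultipliersUpTo N f := by
  intro n hn x m hx
  rcases n.eq_zero_or_pos with rfl | hn₀
  · exact ⟨1, by simpa using hx.hasSphereDeriv.unique .id⟩
  have hper : Function.IsPeriodicPt f n x := hx.isFixedPt
  have hmin : f^[Function.minimalPeriod f x] x = x := Function.isPeriodicPt_minimalPeriod f x
  obtain ⟨q, hq⟩ := hper.minimalPeriod_dvd
  choose d hd using hd
  have hcycle : HasSphereDeriv f^[Function.minimalPeriod f x] x _ :=
    .iterate fun i _ => hd (f^[i] x)
  obtain ⟨k, hk⟩ := hf x _ ((hper.minimalPeriod_le hn₀).trans hn)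
    ⟨⟨n, hn₀, hper⟩, hcycle.hasFixedPointMultiplier hmin⟩
  have hpow : HasSphereDeriv f^[n] x (∏ _i ∈ Finset.range q, (k : ℂ)) := by
    rw [hq, Function.iterate_mul]
    refine .iterate fun i _ => ?_
    rwa [Function.iterate_fixed hmin, ← hk]
  exact ⟨k ^ q, by simpa using hx.hasSphereDeriv.unique hpow⟩

namespace IsFixedPtWithMultiplier

variable {f g : OnePoint ℂ → OnePoint ℂ} {x : OnePoint ℂ} {m : ℂ}

lemma of_orbit {n : ℕ} {z : ℂ} {F D : ℂ → ℂ} (hf : ∀ i < n, f (F^[i] z : ℂ) = (F (F^[i] z) : ℂ))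
    (hD : ∀ i < n, HasSphereDeriv f (F^[i] z : ℂ) (D (F^[i] z))) (hz : F^[n] z = z) :
    IsFixedPtWithMultiplier f^[n] z (∏ i ∈ Finset.range n, D (F^[i] z)) := by
  have horbit : ∀ i ≤ n, f^[i] (z : OnePoint ℂ) = (F^[i] z : ℂ) := by
    intro i
    induction i with
    | zero => simp
    | succ i ih =>
      intro hi
      rw [Function.iterate_succ_apply', ih (by omega), hf i (by omega),
        Function.iterate_succ_apply']
  refine ⟨by rw [horbit n le_rfl, hz], .iterate fun i hi => ?_⟩
  rw [horbit i hi.le]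
  exact hD i hi

lemma conj {φ : GL (Fin 2) ℂ} (hφ : Function.Semiconj (φ • ·) f g)
    (h : IsFixedPtWithMultiplier f x m) : IsFixedPtWithMultiplier g (φ • x) m := by
  obtain ⟨a, ha⟩ := exists_hasSphereDeriv_smul φ x
  obtain ⟨b, hb⟩ := exists_hasSphereDeriv_smul φ⁻¹ (φ • x)
  have hba : b * a = 1 := by
    refine (HasSphereDeriv.comp (f := (φ • ·)) hb ha).unique ?_
    convert HasSphereDeriv.id using 1
    funext y
    simp
  refine ⟨by rw [← hφ x, h.isFixedPt], ?_⟩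
  have hg : g = (φ • ·) ∘ f ∘ (φ⁻¹ • ·) := by
    funext y
    simp [hφ _]
  have hinner : HasSphereDeriv (f ∘ (φ⁻¹ • ·)) (φ • x) (m * b) :=
    .comp (by simpa using h.hasSphereDeriv) hb
  have houter : HasSphereDeriv ((φ • ·) ∘ f ∘ (φ⁻¹ • ·)) (φ • x) (a * (m * b)) :=
    .comp (by simpa [h.isFixedPt] using ha) hinner
  rw [hg]
  convert houter using 1
  linear_combination -m * hba

end IsFixedPtWithMultiplier

namespace AreMoebiusConjugate

variable {f g h : OnePoint ℂ → OnePoint ℂ}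

protected lemma symm (hfg : AreMoebiusConjugate f g) : AreMoebiusConjugate g f := by
  obtain ⟨φ, hφ⟩ := hfg
  exact ⟨φ⁻¹, fun x => by rw [inv_smul_eq_iff, hφ, smul_inv_smul]⟩

protected lemma trans (hfg : AreMoebiusConjugate f g) (hgh : AreMoebiusConjugate g h) :
    AreMoebiusConjugate f h := by
  obtain ⟨φ, hφ⟩ := hfg
  obtain ⟨ψ, hψ⟩ := hgh
  exact ⟨ψ * φ, fun x => by rw [mul_smul, mul_smul, hφ, hψ]⟩

lemma exists_isFixedPtWithMultiplier {x : OnePoint ℂ} {m : ℂ} (hfg : AreMoebiusConjugate f g)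
    (hx : IsFixedPtWithMultiplier f x m) : ∃ y, IsFixedPtWithMultiplier g y m := by
  obtain ⟨φ, hφ⟩ := hfg
  exact ⟨φ • x, hx.conj hφ⟩

end AreMoebiusConjugate

namespace HasIntegerMultipliersUpTo

variable {f g : OnePoint ℂ → OnePoint ℂ} {M N : ℕ}

lemma mono (hMN : M ≤ N) (hf : HasIntegerMultipliersUpTo N f) : HasIntegerMultipliersUpTo M f :=
  fun n hn => hf n (hn.trans hMN)

lemma of_areMoebiusConjugate (hf : HasIntegerMultipliersUpTo N f)
    (hfg : AreMoebiusConjugate f g) : HasIntegerMultipliersUpTo N g := by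
  obtain ⟨φ, hφ⟩ := hfg.symm
  intro n hn x m hx
  exact hf n hn _ m (hx.conj (Function.Semiconj.iterate_right (f := (φ • ·)) hφ n))

lemma exists_int {x : OnePoint ℂ} {m : ℂ} (hf : HasIntegerMultipliersUpTo N f) (hN : 1 ≤ N)
    (hx : IsFixedPtWithMultiplier f x m) : ∃ k : ℤ, m = k :=
  hf 1 hN x m (by rwa [Function.iterate_one])

end HasIntegerMultipliersUpTo

/-! ### Quadratic maps in homogeneous coordinates -/

/-- A pair of binary quadratic forms `a x² + b x y + c y²`, `d x² + e x y + f y²`. -/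
structure QuadPair (K : Type*) where
  (a b c d e f : K)

namespace QuadPair

variable {K : Type*} [Field K]

/-- The first form of the pair, the numerator of `QuadPair.toMap`. -/
def num (F : QuadPair K) (x y : K) : K := F.a * x ^ 2 + F.b * x * y + F.c * y ^ 2

/-- The second form of the pair, the denominator of `QuadPair.toMap`. -/
def den (F : QuadPair K) (x y : K) : K := F.d * x ^ 2 + F.e * x * y + F.f * y ^ 2

/-- The two forms have no common zero on the projective line over `K`. -/
def Nondeg (F : QuadPair K) : Prop :=
  ∀ x y, (x ≠ 0 ∨ y ≠ 0) → F.num x y ≠ 0 ∨ F.den x y ≠ 0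

/-- The self-map `[x : y] ↦ [F.num x y : F.den x y]` of the projective line. -/
def toMap [DecidableEq K] (F : QuadPair K) : OnePoint K → OnePoint K := fun x =>
  x.elim (homPt F.a F.d) (fun z => homPt (F.num z 1) (F.den z 1))

/-- The substitution `(x, y) ↦ (A x + B y, C x + D y)` turns the pair `F` into `G`, up to the
constant factor `κ`. On the projective line it conjugates `F.toMap` to `G.toMap`. -/
structure IsLinearConj (F G : QuadPair K) (A B C D κ : K) : Prop where
  det_ne_zero : A * D - B * C ≠ 0
  factor_ne_zero : κ ≠ 0
  num_eq : ∀ x y,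
    A * F.num x y + B * F.den x y = κ * G.num (A * x + B * y) (C * x + D * y)
  den_eq : ∀ x y,
    C * F.num x y + D * F.den x y = κ * G.den (A * x + B * y) (C * x + D * y)

section

variable (F : QuadPair K)

lemma num_mul (k x y : K) : F.num (k * x) (k * y) = k ^ 2 * F.num x y := by
  simp only [num]; ring

lemma den_mul (k x y : K) : F.den (k * x) (k * y) = k ^ 2 * F.den x y := by
  simp only [den]; ring

lemma num_zero_right (x : K) : F.num x 0 = x ^ 2 * F.a := by simp only [num]; ring

lemma den_zero_right (x : K) : F.den x 0 = x ^ 2 * F.d := by simp only [den]; ring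

variable {F}

lemma Nondeg.a_ne_zero (hF : F.Nondeg) (hd : F.d = 0) : F.a ≠ 0 := by
  simpa [num_zero_right, den_zero_right, hd] using hF 1 0 (by simp)

end

section

variable [DecidableEq K] (F : QuadPair K)

lemma toMap_infty : F.toMap ∞ = homPt F.a F.d := rfl

lemma toMap_coe (z : K) : F.toMap (z : OnePoint K) = homPt (F.num z 1) (F.den z 1) := rfl

lemma toMap_homPt {x y : K} (hxy : x ≠ 0 ∨ y ≠ 0) :
    F.toMap (homPt x y) = homPt (F.num x y) (F.den x y) := by
  by_cases hy : y = 0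
  · subst hy
    have hx : x ≠ 0 := by simpa using hxy
    rw [homPt_zero_right, toMap_infty, num_zero_right, den_zero_right,
      homPt_mul (pow_ne_zero 2 hx)]
  · rw [homPt_of_ne hy, toMap_coe, ← homPt_mul (pow_ne_zero 2 hy), ← num_mul, ← den_mul, mul_one,
      mul_div_cancel₀ _ hy]

end

namespace IsLinearConj

variable {F G : QuadPair K} {A B C D κ : K}

lemma nondeg (h : IsLinearConj F G A B C D κ) (hF : F.Nondeg) : G.Nondeg := by
  intro X Y hXY
  contrapose! hXY
  have hdet := h.det_ne_zero
  have hpreimage : D * X - B * Y = 0 ∧ A * Y - C * X = 0 := by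
    have hx : A * (D * X - B * Y) + B * (A * Y - C * X) = (A * D - B * C) * X := by ring
    have hy : C * (D * X - B * Y) + D * (A * Y - C * X) = (A * D - B * C) * Y := by ring
    have hnum := h.num_eq (D * X - B * Y) (A * Y - C * X)
    have hden := h.den_eq (D * X - B * Y) (A * Y - C * X)
    rw [hx, hy, num_mul, hXY.1, mul_zero, mul_zero] at hnum
    rw [hx, hy, den_mul, hXY.2, mul_zero, mul_zero] at hden
    by_contra! hne
    obtain ⟨hn, hd⟩ := eq_zero_of_det_ne_zero hdet hnum hden
    exact (hF _ _ (not_and_or.1 (not_and.2 hne))).elim (· hn) (· hd)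
  exact eq_zero_of_det_ne_zero (A := D) (B := -B) (C := -C) (D := A)
    (by rwa [neg_mul_neg, mul_comm]) (by linear_combination hpreimage.1)
    (by linear_combination hpreimage.2)

lemma moebius_smul_toMap [DecidableEq K] (h : IsLinearConj F G A B C D κ) (hF : F.Nondeg)
    (x : OnePoint K) :
    moebius h.det_ne_zero • F.toMap x = G.toMap (moebius h.det_ne_zero • x) := by
  obtain ⟨u, v, huv, rfl⟩ := exists_eq_homPt x
  have hne : A * u + B * v ≠ 0 ∨ C * u + D * v ≠ 0 := by
    contrapose! huv
    exact eq_zero_of_det_ne_zero h.det_ne_zero huv.1 huv.2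
  rw [toMap_homPt _ huv, moebius_smul_homPt _ huv, moebius_smul_homPt _ (hF u v huv),
    toMap_homPt _ hne, h.num_eq, h.den_eq, homPt_mul h.factor_ne_zero]

lemma areMoebiusConjugate {F G : QuadPair ℂ} {A B C D κ : ℂ} (h : IsLinearConj F G A B C D κ)
    (hF : F.Nondeg) : AreMoebiusConjugate F.toMap G.toMap :=
  ⟨moebius h.det_ne_zero, h.moebius_smul_toMap hF⟩

end IsLinearConj

/-- The homogenizations in degree `2` of a pair of polynomials. -/
def ofPolynomials (p q : K[X]) : QuadPair K :=
  ⟨p.coeff 2, p.coeff 1, p.coeff 0, q.coeff 2, q.coeff 1, q.coeff 0⟩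

lemma sum_coeff_eq_eval {r : K[X]} (hr : r.natDegree ≤ 2) (z : K) :
    r.coeff 2 * z ^ 2 + r.coeff 1 * z + r.coeff 0 = r.eval z := by
  rw [eval_eq_sum_range' (Nat.lt_succ_of_le hr), Finset.sum_range_succ, Finset.sum_range_succ,
    Finset.sum_range_one]
  ring

lemma ofPolynomials_num {p : K[X]} (hp : p.natDegree ≤ 2) (q : K[X]) (z : K) :
    (ofPolynomials p q).num z 1 = p.eval z := by
  simp only [num, ofPolynomials, mul_one, one_pow, sum_coeff_eq_eval hp]

lemma ofPolynomials_den (p : K[X]) {q : K[X]} (hq : q.natDegree ≤ 2) (z : K) :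
    (ofPolynomials p q).den z 1 = q.eval z := by
  simp only [den, ofPolynomials, mul_one, one_pow, sum_coeff_eq_eval hq]

lemma ratMap_eq_toMap {p q : ℂ[X]} (hpq : max p.natDegree q.natDegree = 2) :
    ratMap p q = (ofPolynomials p q).toMap := by
  funext x
  induction x using OnePoint.rec with
  | infty => simp [ratMap, toMap_infty, ofPolynomials, homPt, hpq]
  | coe z =>
    rw [toMap_coe, ofPolynomials_num (hpq ▸ le_max_left _ _),
      ofPolynomials_den _ (hpq ▸ le_max_right _ _)]
    rfl

lemma nondeg_ofPolynomials {p q : K[X]} (hpq : IsCoprime p q)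
    (hdeg : max p.natDegree q.natDegree = 2) : (ofPolynomials p q).Nondeg := by
  have nondeg_affine (z : K) :
      (ofPolynomials p q).num z 1 ≠ 0 ∨ (ofPolynomials p q).den z 1 ≠ 0 := by
    rw [ofPolynomials_num (hdeg ▸ le_max_left _ _), ofPolynomials_den _ (hdeg ▸ le_max_right _ _)]
    simpa using (isCoprime_iff_aeval_ne_zero p q).1 hpq z
  intro x y hxy
  by_cases hy : y = 0
  · subst hy
    have hx : x ≠ 0 := by simpa using hxy
    suffices p.coeff 2 ≠ 0 ∨ q.coeff 2 ≠ 0 by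
      simpa [num_zero_right, den_zero_right, ofPolynomials, hx] using this
    rcases max_choice p.natDegree q.natDegree with h | h <;> rw [hdeg] at h
    · left; rw [h, coeff_natDegree, leadingCoeff_ne_zero]; rintro rfl; simp at h
    · right; rw [h, coeff_natDegree, leadingCoeff_ne_zero]; rintro rfl; simp at h
  · have hx : x = y * (x / y) := (mul_div_cancel₀ _ hy).symm
    rw [hx, ← mul_one (y : K), mul_assoc, one_mul, num_mul, den_mul]
    simpa [hy] using nondeg_affine (x / y)

/-! ### Derivatives of quadratic maps -/

lemma hasDerivAt_quadratic {𝕜 : Type*} [NontriviallyNormedField 𝕜] (a b c z : 𝕜) :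
    HasDerivAt (fun w => a * w ^ 2 + b * w + c) (2 * a * z + b) z := by
  refine HasDerivAt.congr_deriv (((hasDerivAt_pow 2 z).const_mul a).add
    ((hasDerivAt_id z).const_mul b) |>.add_const c) ?_
  push_cast
  ring

lemma Nondeg.exists_hasSphereDeriv {F : QuadPair ℂ} (hF : F.Nondeg) (x : OnePoint ℂ) :
    ∃ m, HasSphereDeriv F.toMap x m := by
  induction x using OnePoint.rec with
  | infty =>
    refine exists_hasSphereDeriv_of_homPt (P := F.num 1) (Q := F.den 1)
      (fun w => by rw [chartInv_infty, toMap_homPt _ (by simp)]) (hF _ _ (by simp)) ?_ ?_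
    · unfold num; fun_prop
    · unfold den; fun_prop
  | coe z =>
    refine exists_hasSphereDeriv_of_homPt (P := (F.num · 1)) (Q := (F.den · 1))
      (fun w => by rw [chartInv_coe, toMap_coe]) (hF _ _ (by simp)) ?_ ?_
    · unfold num; fun_prop
    · unfold den; fun_prop

lemma hasSphereDeriv_infty {F : QuadPair ℂ} (hd : F.d = 0) (ha : F.a ≠ 0) :
    HasSphereDeriv F.toMap ∞ (F.e / F.a) := by
  have hnum : F.num 1 = fun w => F.c * w ^ 2 + F.b * w + F.a := by
    funext w; simp only [num]; ring
  have hden : F.den 1 = fun w => F.f * w ^ 2 + F.e * w + 0 := by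
    funext w; simp only [den, hd]; ring
  have hnum' := hasDerivAt_quadratic F.c F.b F.a 0
  have hden' := hasDerivAt_quadratic F.f F.e 0 0
  rw [← hnum] at hnum'
  rw [← hden] at hden'
  have ha' : F.num 1 0 ≠ 0 := by simpa [num_zero_right] using ha
  have hd' : F.den 1 0 = 0 := by simpa [den_zero_right] using hd
  refine .of_homPt_of_eq_zero (fun w => ?_) hd' ha' hnum'.continuousAt
    ((hden'.div hnum' ha').congr_deriv ?_)
  · rw [chartInv_infty, toMap_homPt _ (by simp)]
  · rw [hd', num_zero_right]
    field_simp
    ring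

end QuadPair

/-! ### Normal forms -/

section Roots

variable {K : Type*} [Field K] [IsAlgClosed K]

lemma exists_quadratic_root (b c : K) : ∃ z : K, z ^ 2 + b * z + c = 0 := by
  obtain ⟨z, hz⟩ := IsAlgClosed.exists_root (C 1 * X ^ 2 + C b * X + C c : K[X])
    (by rw [degree_quadratic one_ne_zero]; decide)
  exact ⟨z, by simpa using hz⟩

lemma exists_cubic_root (b c d : K) : ∃ z : K, z ^ 3 + b * z ^ 2 + c * z + d = 0 := by
  obtain ⟨z, hz⟩ := IsAlgClosed.exists_root (C 1 * X ^ 3 + C b * X ^ 2 + C c * X + C d : K[X])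
    (by rw [degree_cubic one_ne_zero]; decide)
  exact ⟨z, by simpa using hz⟩

end Roots

/-- The function `z ↦ α z + β + γ / z`. -/
def laurentFn {K : Type*} [Field K] (α β γ z : K) : K := α * z + β + γ / z

lemma laurentFn_eq_iff {K : Type*} [Field K] {α β γ z w : K} (hz : z ≠ 0) :
    laurentFn α β γ z = w ↔ α * z ^ 2 + β * z + γ = z * w := by
  rw [laurentFn, ← mul_right_inj' hz, mul_add, mul_div_cancel₀ _ hz]
  ring_nf

lemma hasDerivAt_laurentFn {𝕜 : Type*} [NontriviallyNormedField 𝕜] (α β γ : 𝕜) {z : 𝕜}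
    (hz : z ≠ 0) : HasDerivAt (laurentFn α β γ) (α - γ / z ^ 2) z := by
  refine HasDerivAt.congr_deriv (f := laurentFn α β γ)
    ((((hasDerivAt_id z).const_mul α).add_const β).add
      ((hasDerivAt_const z γ).div (hasDerivAt_id z) hz)) ?_
  ring

namespace QuadPair

variable {K : Type*} [Field K]

/-- The polynomial map `z ↦ z ^ 2 + c`, with a superattracting fixed point at `∞`. -/
def poly (c : K) : QuadPair K := ⟨1, 0, c, 0, 0, 1⟩

/-- The map `z ↦ α z + β + γ / z`, with a fixed point of multiplier `1 / α` at `∞`. -/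
def laurent (α β γ : K) : QuadPair K := ⟨α, β, γ, 0, 1, 0⟩

/-- The map `z ↦ α z + β + γ / z` with fixed points `∞`, `1` and `r`. -/
def fixedForm (α r : K) : QuadPair K := laurent α ((1 - α) * (1 + r)) (-(1 - α) * r)

lemma laurent_nondeg {α β γ : K} (hα : α ≠ 0) (hγ : γ ≠ 0) : (laurent α β γ).Nondeg := by
  intro x y hxy
  contrapose! hxy
  simp only [num, den, laurent, zero_mul, zero_add, one_mul, add_zero, mul_eq_zero] at hxy
  rcases hxy with ⟨hnum, rfl | rfl⟩
  · simpa [hγ] using hnum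
  · simpa [hα] using hnum

section

variable [DecidableEq K]

lemma poly_toMap_coe (c z : K) :
    (poly c).toMap (z : OnePoint K) = ((z ^ 2 + c : K) : OnePoint K) := by
  rw [toMap_coe, ← homPt_one_right]
  simp [poly, num, den]

lemma laurent_toMap_coe (α β γ : K) {z : K} (hz : z ≠ 0) :
    (laurent α β γ).toMap (z : OnePoint K) = ((laurentFn α β γ z : K) : OnePoint K) := by
  have hden : (laurent α β γ).den z 1 = z := by simp [laurent, den]
  rw [toMap_coe, hden, homPt_of_ne hz]
  congr 1
  simp only [laurent, num, laurentFn]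
  field_simp

end

lemma poly_isFixedPtWithMultiplier_iterate {c z : ℂ} {n : ℕ}
    (hz : (fun w => w ^ 2 + c)^[n] z = z) :
    IsFixedPtWithMultiplier (poly c).toMap^[n] z
      (∏ i ∈ Finset.range n, 2 * (fun w => w ^ 2 + c)^[i] z) := by
  refine .of_orbit (D := fun w => 2 * w) (fun i _ => poly_toMap_coe c _) (fun i _ => ?_) hz
  refine .of_coe (.of_forall (poly_toMap_coe c)) ?_
  simpa using (hasDerivAt_pow 2 _).add_const c

lemma laurent_isFixedPtWithMultiplier_iterate {α β γ z : ℂ} {n : ℕ}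
    (hne : ∀ i < n, (laurentFn α β γ)^[i] z ≠ 0) (hz : (laurentFn α β γ)^[n] z = z) :
    IsFixedPtWithMultiplier (laurent α β γ).toMap^[n] z
      (∏ i ∈ Finset.range n, (α - γ / ((laurentFn α β γ)^[i] z) ^ 2)) := by
  refine .of_orbit (D := fun w => α - γ / w ^ 2)
    (fun i hi => laurent_toMap_coe α β γ (hne i hi)) (fun i hi => ?_) hz
  refine .of_coe ?_ (hasDerivAt_laurentFn α β γ (hne i hi))
  filter_upwards [eventually_ne_nhds (hne i hi)] with w hw using laurent_toMap_coe α β γ hw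

lemma laurent_isFixedPtWithMultiplier {α β γ z : ℂ} (hz₀ : z ≠ 0) (hz : laurentFn α β γ z = z) :
    IsFixedPtWithMultiplier (laurent α β γ).toMap z (α - γ / z ^ 2) := by
  simpa using laurent_isFixedPtWithMultiplier_iterate (n := 1) (by simpa using hz₀) (by simpa)

section

variable {F : QuadPair K}

lemma exists_isLinearConj_of_num_eq {z : K} (hz : F.num z 1 = z * F.den z 1) :
    ∃ G : QuadPair K, G.d = 0 ∧ IsLinearConj F G 0 1 1 (-z) 1 := by
  refine ⟨⟨F.den z 1, 2 * F.d * z + F.e, F.d, 0,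
    2 * F.a * z + F.b - z * (2 * F.d * z + F.e), F.a - z * F.d⟩, rfl,
    by simp, one_ne_zero, fun x y => ?_, fun x y => ?_⟩
  · simp only [num, den]
    ring
  · simp only [num, den] at hz ⊢
    linear_combination y ^ 2 * hz

lemma isLinearConj_poly [NeZero (2 : K)] (hd : F.d = 0) (he : F.e = 0) (ha : F.a ≠ 0)
    (hf : F.f ≠ 0) :
    IsLinearConj F (poly (F.a * F.c / F.f ^ 2 + F.b / (2 * F.f) - (F.b / (2 * F.f)) ^ 2))
      (F.a / F.f) (F.b / (2 * F.f)) 0 1 F.f := by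
  have two_ne : (2 : K) ≠ 0 := two_ne_zero
  refine ⟨by simp [ha, hf], hf, fun x y => ?_, fun x y => ?_⟩
  · simp only [num, den, poly, hd, he]
    field_simp
    ring
  · simp only [num, den, poly, hd, he]
    ring

lemma isLinearConj_laurent (hd : F.d = 0) (he : F.e ≠ 0) :
    IsLinearConj F (laurent (F.a / F.e) (F.b + F.f - 2 * F.a * F.f / F.e)
      (F.a * F.f ^ 2 / F.e - F.b * F.f + F.c * F.e)) F.e F.f 0 1 1 := by
  refine ⟨by simpa using he, one_ne_zero, fun x y => ?_, fun x y => ?_⟩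
  · simp only [num, den, laurent, hd]
    field_simp
    ring
  · simp only [num, den, laurent, hd]
    ring

lemma isLinearConj_laurent_scale (α β γ : K) {t : K} (ht : t ≠ 0) :
    IsLinearConj (laurent α β γ) (laurent α (t * β) (t ^ 2 * γ)) t 0 0 1 t⁻¹ := by
  refine ⟨by simpa using ht, inv_ne_zero ht, fun x y => ?_, fun x y => ?_⟩ <;>
  · simp only [laurent, num, den]
    field_simp
    ring

lemma Nondeg.exists_fixedPt [DecidableEq K] [IsAlgClosed K] (hF : F.Nondeg) :
    ∃ x, F.toMap x = x := by
  by_cases hd : F.d = 0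
  · exact ⟨∞, by rw [toMap_infty, hd, homPt_zero_right]⟩
  obtain ⟨z, hz⟩ := exists_cubic_root ((F.e - F.a) / F.d) ((F.f - F.b) / F.d) (-F.c / F.d)
  have hnum : F.num z 1 = z * F.den z 1 := by
    simp only [num, den]
    field_simp at hz
    linear_combination -hz
  have hden : F.den z 1 ≠ 0 := by
    intro hden
    exact (hF z 1 (by simp)).elim (· (by rw [hnum, hden, mul_zero])) (· hden)
  exact ⟨z, by rw [toMap_coe, homPt_of_ne hden, hnum, mul_div_cancel_right₀ _ hden]⟩

lemma Nondeg.exists_semiconj_infty [DecidableEq K] (hF : F.Nondeg) {x : OnePoint K}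
    (hx : F.toMap x = x) :
    ∃ G : QuadPair K, G.Nondeg ∧ G.d = 0 ∧
      ∃ φ : GL (Fin 2) K, Function.Semiconj (φ • ·) F.toMap G.toMap ∧ φ • x = ∞ := by
  induction x using OnePoint.rec with
  | infty =>
    refine ⟨F, hF, ?_, 1, fun _ => by simp, by simp⟩
    by_contra hd
    rw [toMap_infty, homPt_of_ne hd] at hx
    exact OnePoint.coe_ne_infty _ hx
  | coe z =>
    have hden : F.den z 1 ≠ 0 := by
      intro hden
      rw [toMap_coe, hden, homPt_zero_right] at hx
      exact OnePoint.infty_ne_coe _ hx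
    rw [toMap_coe, homPt_of_ne hden, OnePoint.coe_eq_coe, div_eq_iff hden] at hx
    obtain ⟨G, hd, hFG⟩ := exists_isLinearConj_of_num_eq hx
    refine ⟨G, hFG.nondeg hF, hd, moebius hFG.det_ne_zero, hFG.moebius_smul_toMap hF, ?_⟩
    rw [← homPt_one_right, moebius_smul_homPt _ (by simp)]
    simp [homPt_zero_right]

end

section

variable {F : QuadPair ℂ} {x : OnePoint ℂ} {m : ℂ}

lemma Nondeg.exists_conj_fixing_infty (hF : F.Nondeg) (hx : IsFixedPtWithMultiplier F.toMap x m) :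
    ∃ G : QuadPair ℂ, G.Nondeg ∧ G.d = 0 ∧ m = G.e / G.a ∧
      AreMoebiusConjugate F.toMap G.toMap := by
  obtain ⟨G, hG, hd, φ, hφ, hφx⟩ := hF.exists_semiconj_infty hx.isFixedPt
  have hderiv := (hx.conj hφ).hasSphereDeriv
  rw [hφx] at hderiv
  exact ⟨G, hG, hd, hderiv.unique (hasSphereDeriv_infty hd (hG.a_ne_zero hd)), φ, hφ⟩

lemma Nondeg.exists_conj_poly (hF : F.Nondeg) (hx : IsFixedPtWithMultiplier F.toMap x 0) :
    ∃ c, AreMoebiusConjugate F.toMap (poly c).toMap := by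
  obtain ⟨G, hG, hd, hm, hFG⟩ := hF.exists_conj_fixing_infty hx
  have ha := hG.a_ne_zero hd
  have he : G.e = 0 := by simpa [ha] using hm.symm
  have hf : G.f ≠ 0 := by
    intro hf
    obtain ⟨z, hz⟩ := exists_quadratic_root (G.b / G.a) (G.c / G.a)
    refine (hG z 1 (by simp)).elim (· ?_) (· ?_)
    · simp only [num]
      field_simp at hz
      linear_combination hz
    · simp [den, hd, he, hf]
  exact ⟨_, hFG.trans ((isLinearConj_poly hd he ha hf).areMoebiusConjugate hG)⟩

lemma Nondeg.exists_conj_laurent (hF : F.Nondeg) (hx : IsFixedPtWithMultiplier F.toMap x m)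
    (hm : m ≠ 0) : ∃ β γ, γ ≠ 0 ∧ AreMoebiusConjugate F.toMap (laurent m⁻¹ β γ).toMap := by
  obtain ⟨G, hG, hd, rfl, hFG⟩ := hF.exists_conj_fixing_infty hx
  have hconj := isLinearConj_laurent hd (div_ne_zero_iff.1 hm).1
  rw [inv_div]
  refine ⟨_, _, ?_, hFG.trans (hconj.areMoebiusConjugate hG)⟩
  simpa [num, den, laurent] using hconj.nondeg hG 0 1 (by simp)

lemma exists_laurent_conj_fixedForm {α β γ : ℂ} (hα₀ : α ≠ 0) (hα₁ : α ≠ 1) (hγ : γ ≠ 0) :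
    ∃ r ≠ 0, AreMoebiusConjugate (laurent α β γ).toMap (fixedForm α r).toMap := by
  have hα : 1 - α ≠ 0 := sub_ne_zero.2 hα₁.symm
  obtain ⟨v, hv⟩ := exists_quadratic_root (-β / (1 - α)) (-γ / (1 - α))
  obtain ⟨w, hw⟩ : ∃ w, w = β / (1 - α) - v := ⟨_, rfl⟩
  have hsum : β = (1 - α) * (v + w) := by
    rw [hw]; field_simp; ring
  have hprod : γ = -(1 - α) * (v * w) := by
    rw [hw]
    field_simp at hv ⊢
    linear_combination -hv
  have hv₀ : v ≠ 0 := by rintro rfl; simp [hprod] at hγ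
  have hw₀ : w ≠ 0 := by rintro rfl; simp [hprod] at hγ
  refine ⟨w / v, div_ne_zero hw₀ hv₀, ?_⟩
  convert (isLinearConj_laurent_scale α β γ (inv_ne_zero hv₀)).areMoebiusConjugate
    (laurent_nondeg hα₀ hγ) using 2
  rw [fixedForm, hsum, hprod]
  congr 1 <;> field_simp

end

lemma fixedForm_isFixedPtWithMultiplier_one (α r : ℂ) :
    IsFixedPtWithMultiplier (fixedForm α r).toMap (1 : ℂ) (1 - (1 - α) * (1 - r)) := by
  have hfix : laurentFn α ((1 - α) * (1 + r)) (-(1 - α) * r) 1 = 1 := by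
    simp only [laurentFn]
    ring
  have hmult : 1 - (1 - α) * (1 - r) = α - -(1 - α) * r / 1 ^ 2 := by ring
  exact hmult ▸ laurent_isFixedPtWithMultiplier one_ne_zero hfix

lemma fixedForm_isFixedPtWithMultiplier_right (α : ℂ) {r : ℂ} (hr : r ≠ 0) :
    IsFixedPtWithMultiplier (fixedForm α r).toMap r (1 - (1 - α) * (1 - r⁻¹)) := by
  have hfix : laurentFn α ((1 - α) * (1 + r)) (-(1 - α) * r) r = r := by
    simp only [laurentFn]
    field_simp
    ring
  have hmult : 1 - (1 - α) * (1 - r⁻¹) = α - -(1 - α) * r / r ^ 2 := by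
    field_simp
    ring
  exact hmult ▸ laurent_isFixedPtWithMultiplier hr hfix

/-- The holomorphic fixed point formula `∑ 1 / (1 - μ) = 1` for the three fixed points. -/
lemma fixedForm_sum_inv {α r : K} (hα₀ : α ≠ 0) (hα₁ : α ≠ 1) (hr₀ : r ≠ 0) (hr₁ : r ≠ 1) :
    (1 - α⁻¹)⁻¹ + ((1 - α) * (1 - r))⁻¹ + ((1 - α) * (1 - r⁻¹))⁻¹ = 1 := by
  have hα : 1 - α ≠ 0 := sub_ne_zero.2 hα₁.symm
  have hα' : α - 1 ≠ 0 := sub_ne_zero.2 hα₁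
  have hr : 1 - r ≠ 0 := sub_ne_zero.2 hr₁.symm
  have hr' : r - 1 ≠ 0 := sub_ne_zero.2 hr₁
  field_simp
  ring

end QuadPair

/-! ### Integer equations -/

lemma isSquare_of_isSquare_sq_mul {d k : ℤ} (hd : d ≠ 0) (h : IsSquare (d ^ 2 * k)) :
    IsSquare k := by
  obtain ⟨m, hm⟩ := h
  have hdvd : d ∣ m := (Int.pow_dvd_pow_iff two_ne_zero).1 ⟨k, by rw [hm, sq]⟩
  obtain ⟨j, rfl⟩ := hdvd
  exact ⟨j, mul_left_cancel₀ (pow_ne_zero 2 hd) (by linear_combination hm)⟩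

lemma sq_eq_nine_of_isSquare_sq_sub_eight {n : ℤ} (h : IsSquare (n ^ 2 - 8)) : n ^ 2 = 9 := by
  obtain ⟨j, hj⟩ := h
  obtain ⟨u, hu⟩ : ∃ u, u = n - j := ⟨_, rfl⟩
  have hprod : u * (2 * n - u) = 8 := by rw [hu]; linear_combination hj
  have hdvd : u ∣ 8 := ⟨_, hprod.symm⟩
  have hle : u ≤ 8 := Int.le_of_dvd (by norm_num) hdvd
  have hge : -u ≤ 8 := Int.le_of_dvd (by norm_num) (neg_dvd.2 hdvd)
  have hn : n = 3 ∨ n = -3 := by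
    have : -8 ≤ u := by linarith
    clear hu hdvd hge
    interval_cases u <;> omega
  rcases hn with rfl | rfl <;> norm_num

lemma eq_of_isSquare_sq_sub_three_mul {a : ℤ} (ha : a ≠ 0) (h : IsSquare (a ^ 2 - 3 * a)) :
    a = -1 ∨ a = 3 ∨ a = 4 := by
  obtain ⟨j, hj⟩ := h
  obtain ⟨u, hu⟩ : ∃ u, u = 2 * a - 3 - 2 * j := ⟨_, rfl⟩
  have hprod : u * (4 * a - 6 - u) = 9 := by rw [hu]; linear_combination 4 * hj
  have hdvd : u ∣ 9 := ⟨_, hprod.symm⟩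
  have hle : u ≤ 9 := Int.le_of_dvd (by norm_num) hdvd
  have hge : -u ≤ 9 := Int.le_of_dvd (by norm_num) (neg_dvd.2 hdvd)
  have : -9 ≤ u := by linarith
  clear hu hdvd hge
  interval_cases u <;> omega

lemma inv_intCast_le_third {n : ℤ} (hn : n < 0 ∨ 2 < n) : (n : ℚ)⁻¹ ≤ 3⁻¹ := by
  rcases hn with hneg | hpos
  · have : (n : ℚ) < 0 := by exact_mod_cast hneg
    exact (inv_lt_zero.2 this).le.trans (by norm_num)
  · have : (3 : ℚ) ≤ n := by exact_mod_cast hpos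
    gcongr

lemma eq_three_of_sum_inv_eq_one {a b c : ℤ} (ha : a < 0 ∨ 2 < a) (hb : b < 0 ∨ 2 < b)
    (hc : c < 0 ∨ 2 < c) (h : (a : ℚ)⁻¹ + (b : ℚ)⁻¹ + (c : ℚ)⁻¹ = 1) : a = 3 ∧ b = 3 := by
  have ha' := inv_intCast_le_third ha
  have hb' := inv_intCast_le_third hb
  have hc' := inv_intCast_le_third hc
  have haeq : (a : ℚ)⁻¹ = 3⁻¹ := by linarith
  have hbeq : (b : ℚ)⁻¹ = 3⁻¹ := by linarith
  rw [inv_inj] at haeq hbeq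
  exact ⟨by exact_mod_cast haeq, by exact_mod_cast hbeq⟩

lemma eq_of_inv_add_inv_eq_half {b c : ℤ} (hb₀ : b ≠ 0) (hb₁ : b ≠ 1) (hc₀ : c ≠ 0) (hc₁ : c ≠ 1)
    (h : (b : ℚ)⁻¹ + (c : ℚ)⁻¹ = 2⁻¹) : b = 3 ∨ b = 4 ∨ b = 6 := by
  have hprod : (b - 2) * (c - 2) = 4 := by
    have : (b : ℚ) ≠ 0 := by exact_mod_cast hb₀
    have : (c : ℚ) ≠ 0 := by exact_mod_cast hc₀
    have : ((b : ℚ) - 2) * (c - 2) = 4 := by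
      field_simp at h
      linear_combination -h
    exact_mod_cast this
  have hdvd : b - 2 ∣ 4 := ⟨_, hprod.symm⟩
  have hle : b - 2 ≤ 4 := Int.le_of_dvd (by norm_num) hdvd
  have hge : -(b - 2) ≤ 4 := Int.le_of_dvd (by norm_num) (neg_dvd.2 hdvd)
  have : b ≤ 6 := by linarith
  have : -2 ≤ b := by linarith
  clear h hdvd hle hge
  interval_cases b <;> omega

/-! ### Cycles of length three -/

namespace QuadPair

/- The points of period three of `z ↦ z ^ 2 + c` form two cycles, whose sums are the roots `s` of
`s ^ 2 + s + 2 + c`; the cycle with sum `s` consists of the roots of the cubic below. -/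
lemma exists_poly_iterate_three_isFixedPtWithMultiplier {c s : ℂ} (hs : s ^ 2 + s + 2 + c = 0) :
    ∃ z : ℂ, IsFixedPtWithMultiplier (poly c).toMap^[3] z (8 * (1 + c + c * s)) := by
  obtain ⟨z, hz⟩ := exists_cubic_root (-s) (c - s - 1) (-(1 + c + c * s))
  obtain ⟨F, hF⟩ : ∃ F : ℂ → ℂ, F = fun w => w ^ 2 + c := ⟨_, rfl⟩
  have hsecond : F (F z) = s - z - F z := by
    simp only [hF]
    linear_combination (z + s) * hz + (z ^ 2 + z + c) * hs
  have hthird : F (F (F z)) = z := by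
    rw [hsecond]
    simp only [hF]
    linear_combination (z + 2 + s) * hz + (z ^ 2 + z + 1 + c) * hs
  have hprod : F z * F (F z) = z ^ 2 - s * z + (c - s - 1) := by
    rw [hsecond]
    simp only [hF]
    linear_combination -((z + 1 + s) * hz + (z ^ 2 + z + c) * hs)
  refine ⟨z, ?_⟩
  convert poly_isFixedPtWithMultiplier_iterate (c := c) (n := 3) (hF ▸ hthird) using 1
  simp only [← hF, Finset.prod_range_succ, Finset.prod_range_zero, Function.iterate_succ,
    Function.iterate_zero, Function.comp, id]
  linear_combination -8 * z * hprod - 8 * hz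

lemma sq_eq_of_hasIntegerMultipliersUpTo_poly {n : ℤ} {c : ℂ} (hc : 4 * c = 1 - (n : ℂ) ^ 2)
    (h : HasIntegerMultipliersUpTo 3 (poly c).toMap) : n ^ 2 = 1 ∨ n ^ 2 = 9 := by
  obtain ⟨s, hs⟩ := exists_quadratic_root 1 (2 + c)
  obtain ⟨z, hz⟩ := exists_poly_iterate_three_isFixedPtWithMultiplier
    (c := c) (s := s) (by linear_combination hs)
  obtain ⟨m, hm⟩ := h 3 le_rfl _ _ hz
  have hdisc : (2 * s + 1) ^ 2 = (n : ℂ) ^ 2 - 8 := by linear_combination 4 * hs - hc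
  have hmult : (m : ℂ) - 9 + (n : ℂ) ^ 2 = (1 - (n : ℂ) ^ 2) * (2 * s + 1) := by
    linear_combination (2 * s + 1) * hc - hm + hc
  have hsq : (1 - n ^ 2) ^ 2 * (n ^ 2 - 8) = (m - 9 + n ^ 2) * (m - 9 + n ^ 2) := by
    have : (1 - (n : ℂ) ^ 2) ^ 2 * ((n : ℂ) ^ 2 - 8) =
        ((m : ℂ) - 9 + (n : ℂ) ^ 2) * ((m : ℂ) - 9 + (n : ℂ) ^ 2) := by
      rw [hmult, ← hdisc]
      ring
    exact_mod_cast this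
  rcases eq_or_ne (n ^ 2) 1 with hn | hn
  · exact .inl hn
  · exact .inr (sq_eq_nine_of_isSquare_sq_sub_eight
      (isSquare_of_isSquare_sq_mul (sub_ne_zero.2 hn.symm) ⟨_, hsq⟩))

/- As for polynomials, the two cycles of length three of `z ↦ z + 1 + k / z` are indexed by the
roots `s` of a quadratic polynomial; here the sum of the cycle is `s - 1`. -/
lemma exists_laurentFn_threeCycle {k s : ℂ} (hk : k ≠ 0) (hs : s ^ 2 + 2 * s + 3 * k = 0) :
    ∃ u v w : ℂ, laurentFn 1 1 k u = v ∧ laurentFn 1 1 k v = w ∧ laurentFn 1 1 k w = u ∧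
      u + v + w = s - 1 ∧ u * v + u * w + v * w = -s ∧ u * v * w = k * s / 3 ∧
      u * v * w ≠ 0 := by
  have hs₀ : s ≠ 0 := by
    rintro rfl
    exact hk (by linear_combination hs / 3)
  obtain ⟨u, hu⟩ := exists_cubic_root (-(s - 1)) (-s) (-(k * s / 3))
  have hu₀ : u ≠ 0 := by
    rintro rfl
    exact mul_ne_zero hk hs₀ (by linear_combination -3 * hu)
  obtain ⟨v, hv⟩ : ∃ v, v = laurentFn 1 1 k u := ⟨_, rfl⟩
  obtain ⟨w, hw⟩ : ∃ w, w = s - 1 - u - v := ⟨_, rfl⟩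
  have hsv : s * v = 3 * u ^ 2 + (3 - 2 * s) * u - 2 * s := by
    rw [hv, laurentFn]
    field_simp
    linear_combination (-3) * hu
  have hsw : s * w = -3 * u ^ 2 + (s - 3) * u + s ^ 2 + s := by
    linear_combination s * hw - hsv
  have hvw : v * w = u ^ 2 - (s - 1) * u - s := by
    refine mul_left_cancel₀ (pow_ne_zero 2 hs₀) ?_
    linear_combination (s * w) * hsv + (3 * u ^ 2 + (3 - 2 * s) * u - 2 * s) * hsw
      + (-9 * u - 9) * hu - s * (u + 1) * hs
  have hprod : u * v * w = k * s / 3 := by linear_combination u * hvw + hu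
  have hprod₀ : u * v * w ≠ 0 := by simp [hprod, hk, hs₀]
  have hv₀ : v ≠ 0 := by rintro rfl; simp at hprod₀
  have hw₀ : w ≠ 0 := by rintro rfl; simp at hprod₀
  have hv_eq : v * w = v ^ 2 + v + k := by
    refine mul_left_cancel₀ (pow_ne_zero 2 hs₀) ?_
    linear_combination (s * w - s * v - (3 * u ^ 2 + (3 - 2 * s) * u - 2 * s) - s) * hsv
      + (3 * u ^ 2 + (3 - 2 * s) * u - 2 * s) * hsw
      + (-18 * u - 18 + 3 * s) * hu - 2 * s * (u + 1) * hs
  have hw_eq : w * u = w ^ 2 + w + k := by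
    refine mul_left_cancel₀ (pow_ne_zero 2 hs₀) ?_
    linear_combination (s * u - s * w - (-3 * u ^ 2 + (s - 3) * u + s ^ 2 + s) - s) * hsw
      - (9 * u + 9 + 6 * s) * hu - s * (u + 1 + s) * hs
  exact ⟨u, v, w, hv.symm, (laurentFn_eq_iff hv₀).2 (by linear_combination -hv_eq),
    (laurentFn_eq_iff hw₀).2 (by linear_combination -hw_eq), by rw [hw]; ring,
    by rw [hvw, hw]; ring, hprod, hprod₀⟩

lemma exists_laurent_iterate_three_isFixedPtWithMultiplier {a s : ℂ} (ha : a ≠ 0)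
    (hs : s ^ 2 + 2 * s + 3 * a⁻¹ = 0) :
    ∃ z : ℂ, IsFixedPtWithMultiplier (laurent 1 1 a⁻¹).toMap^[3] z
      (4 * a ^ 2 - 12 * a + 19 + 2 * a ^ 2 * s) := by
  obtain ⟨u, v, w, huv, hvw, hwu, hsum, hsum₂, hprod, hprod₀⟩ :=
    exists_laurentFn_threeCycle (inv_ne_zero ha) hs
  obtain ⟨⟨hu₀, hv₀⟩, hw₀⟩ : (u ≠ 0 ∧ v ≠ 0) ∧ w ≠ 0 := by simpa [not_or] using hprod₀
  have hcycle := laurent_isFixedPtWithMultiplier_iterate (n := 3)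
    (α := 1) (β := 1) (γ := a⁻¹) (z := u)
    (by intro i hi; interval_cases i <;> simpa [huv, hvw]) (by simp [huv, hvw, hwu])
  refine ⟨u, ?_⟩
  convert hcycle using 1
  simp only [Finset.prod_range_succ, Finset.prod_range_zero, Function.iterate_succ,
    Function.iterate_zero, Function.comp, id, one_mul, huv, hvw]
  have hmult : (1 - a⁻¹ / u ^ 2) * (1 - a⁻¹ / v ^ 2) * (1 - a⁻¹ / w ^ 2) * (a⁻¹ * s / 3) ^ 2 =
      ((s - 1) * a⁻¹ + a⁻¹ * s / 3) ^ 2 - a⁻¹ * (a⁻¹ - s) ^ 2 := by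
    rw [sub_eq_add_neg a⁻¹ s, ← hprod, ← hsum, ← hsum₂]
    field_simp
    ring
  have hs₀ : s ≠ 0 := by rintro rfl; exact hprod₀ (by simpa using hprod)
  refine mul_right_cancel₀ (pow_ne_zero 2 (show a⁻¹ * s / 3 ≠ 0 by simp [ha, hs₀])) ?_
  rw [hmult]
  have hinv : a * a⁻¹ = 1 := mul_inv_cancel₀ ha
  generalize a⁻¹ = k at *
  linear_combination s ^ 2 / 9 * ((4 + 2 * s) * (a * k + 1) - 12 * k) * hinv
    + (3 * k ^ 2 - 3 * k + 2 * s) / 9 * hs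

lemma eq_of_hasIntegerMultipliersUpTo_laurent {a : ℤ} (ha : a ≠ 0)
    (h : HasIntegerMultipliersUpTo 3 (laurent 1 1 (a : ℂ)⁻¹).toMap) :
    a = -1 ∨ a = 3 ∨ a = 4 := by
  have ha' : (a : ℂ) ≠ 0 := by exact_mod_cast ha
  obtain ⟨s, hs⟩ := exists_quadratic_root 2 (3 * (a : ℂ)⁻¹)
  obtain ⟨z, hz⟩ := exists_laurent_iterate_three_isFixedPtWithMultiplier ha' hs
  obtain ⟨m, hm⟩ := h 3 le_rfl _ _ hz
  have hsq : (2 * a) ^ 2 * (a ^ 2 - 3 * a) =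
      (m - 2 * a ^ 2 + 12 * a - 19) * (m - 2 * a ^ 2 + 12 * a - 19) := by
    have : (2 * (a : ℂ)) ^ 2 * ((a : ℂ) ^ 2 - 3 * a) =
        (m - 2 * a ^ 2 + 12 * a - 19) * (m - 2 * a ^ 2 + 12 * a - 19) := by
      rw [← hm]
      field_simp at hs
      linear_combination -4 * (a : ℂ) ^ 3 * hs
    exact_mod_cast this
  exact eq_of_isSquare_sq_sub_three_mul ha
    (isSquare_of_isSquare_sq_mul (mul_ne_zero two_ne_zero ha) ⟨_, hsq⟩)

end QuadPair

/-! ### Enclosures of real cycles -/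

section Enclosure

open Set

lemma mem_uIcc_iff_mul_nonpos {a b x : ℝ} : x ∈ uIcc a b ↔ (x - a) * (x - b) ≤ 0 := by
  rw [mem_uIcc, mul_nonpos_iff, sub_nonneg, sub_nonneg, sub_nonpos, sub_nonpos]
  tauto

lemma mul_pos_of_mem_uIcc {a b x : ℝ} (hab : 0 < a * b) (hx : x ∈ uIcc a b) :
    0 < a * x ∧ 0 < b * x := by
  rcases pos_and_pos_or_neg_and_neg_of_mul_pos hab with ⟨ha, hb⟩ | ⟨ha, hb⟩
  · have hx₀ : 0 < x := (lt_min ha hb).trans_le hx.1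
    exact ⟨mul_pos ha hx₀, mul_pos hb hx₀⟩
  · have hx₀ : x < 0 := hx.2.trans_lt (max_lt ha hb)
    exact ⟨mul_pos_of_neg_of_neg ha hx₀, mul_pos_of_neg_of_neg hb hx₀⟩

lemma abs_mem_uIcc {a b x : ℝ} (hab : 0 < a * b) (hx : x ∈ uIcc a b) : |x| ∈ uIcc |a| |b| := by
  obtain ⟨hax, hbx⟩ := mul_pos_of_mem_uIcc hab hx
  rw [mem_uIcc_iff_mul_nonpos] at hx ⊢
  have hab' : |a| * |b| = a * b := by rw [← abs_mul, abs_of_pos hab]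
  have hax' : |a| * |x| = a * x := by rw [← abs_mul, abs_of_pos hax]
  have hbx' : |b| * |x| = b * x := by rw [← abs_mul, abs_of_pos hbx]
  linear_combination hx + sq_abs x + hab' - hax' - hbx'

lemma mul_mem_uIcc_sq {a b x y : ℝ} (hab : 0 < a * b) (hx : x ∈ uIcc a b) (hy : y ∈ uIcc a b) :
    x * y ∈ uIcc (a ^ 2) (b ^ 2) := by
  wlog hle : a ≤ b generalizing a b
  · rw [uIcc_comm] at hx hy ⊢
    exact this (by rwa [mul_comm]) hx hy (le_of_not_ge hle)
  rw [uIcc_of_le hle] at hx hy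
  obtain ⟨⟨hax, hxb⟩, ⟨hay, hyb⟩⟩ := And.intro hx hy
  rcases pos_and_pos_or_neg_and_neg_of_mul_pos hab with ⟨ha, -⟩ | ⟨-, hb⟩
  · exact Icc_subset_uIcc ⟨by nlinarith, by nlinarith⟩
  · exact Icc_subset_uIcc' ⟨by nlinarith, by nlinarith⟩

lemma sub_div_mem_uIcc (α γ : ℝ) {a b x : ℝ} (ha : 0 < a) (hb : 0 < b) (hx : x ∈ uIcc a b) :
    α - γ / x ∈ uIcc (α - γ / a) (α - γ / b) := by
  have hx₀ : 0 < x := (lt_min ha hb).trans_le hx.1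
  rw [mem_uIcc_iff_mul_nonpos] at hx ⊢
  have hprod : (α - γ / x - (α - γ / a)) * (α - γ / x - (α - γ / b)) =
      γ ^ 2 / (x ^ 2 * a * b) * ((x - a) * (x - b)) := by
    field_simp
    ring
  rw [hprod]
  exact mul_nonpos_of_nonneg_of_nonpos (by positivity) hx

lemma laurentFn_mem_uIcc {α β γ a b x : ℝ} (hab : 0 < a * b)
    (hderiv : 0 < (α - γ / a ^ 2) * (α - γ / b ^ 2)) (hx : x ∈ uIcc a b) :
    laurentFn α β γ x ∈ uIcc (laurentFn α β γ a) (laurentFn α β γ b) := by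
  obtain ⟨⟨ha, hb⟩, -, hx₀⟩ : (a ≠ 0 ∧ b ≠ 0) ∧ a ≠ 0 ∧ x ≠ 0 :=
    ⟨mul_ne_zero_iff.1 hab.ne', mul_ne_zero_iff.1 (mul_pos_of_mem_uIcc hab hx).1.ne'⟩
  have hpos {y : ℝ} (hy : y ∈ uIcc a b) : 0 < (α - γ / a ^ 2) * (α - γ / (y * x)) :=
    (mul_pos_of_mem_uIcc hderiv <| sub_div_mem_uIcc α γ (by positivity) (by positivity) <|
      mul_mem_uIcc_sq hab hy hx).1
  have hslope : 0 < (α - γ / (a * x)) * (α - γ / (b * x)) := by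
    refine pos_of_mul_pos_right ?_ (sq_nonneg (α - γ / a ^ 2))
    linear_combination mul_pos (hpos left_mem_uIcc) (hpos right_mem_uIcc)
  rw [mem_uIcc_iff_mul_nonpos] at hx ⊢
  have hprod : (laurentFn α β γ x - laurentFn α β γ a) * (laurentFn α β γ x - laurentFn α β γ b) =
      (α - γ / (a * x)) * (α - γ / (b * x)) * ((x - a) * (x - b)) := by
    simp only [laurentFn]
    field_simp
    ring
  rw [hprod]
  exact mul_nonpos_of_nonneg_of_nonpos hslope.le hx

section Iterate

variable {n : ℕ} {f : ℝ → ℝ} {I : Fin (n + 1) → Set ℝ}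

lemma mapsTo_iterate_of_forall_mapsTo
    (hf : ∀ i : Fin n, MapsTo f (I i.castSucc) (I i.succ)) (i : Fin (n + 1)) :
    MapsTo f^[i] (I 0) (I i) := by
  induction i using Fin.induction with
  | zero => exact mapsTo_id _
  | succ i ih =>
    rw [Fin.val_succ, Function.iterate_succ']
    exact (hf i).comp ih

lemma continuousOn_iterate_of_forall_mapsTo (hcont : ∀ i, ContinuousOn f (I i))
    (hf : ∀ i : Fin n, MapsTo f (I i.castSucc) (I i.succ)) (i : Fin (n + 1)) :
    ContinuousOn f^[i] (I 0) := by
  induction i using Fin.induction with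
  | zero => exact continuousOn_id
  | succ i ih =>
    rw [Fin.val_succ, Function.iterate_succ']
    exact (hcont _).comp ih (mapsTo_iterate_of_forall_mapsTo hf i.castSucc)

lemma exists_iterate_eq_self_of_mul_nonpos {a b : ℝ} (hI : I 0 = uIcc a b)
    (hcont : ∀ i, ContinuousOn f (I i)) (hf : ∀ i : Fin n, MapsTo f (I i.castSucc) (I i.succ))
    (hab : (f^[n + 1] a - a) * (f^[n + 1] b - b) ≤ 0) :
    ∃ x, f^[n + 1] x = x ∧ ∀ i : Fin (n + 1), f^[i] x ∈ I i := by
  have hiter : ContinuousOn f^[n + 1] (I 0) := by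
    rw [Function.iterate_succ']
    exact (hcont _).comp (continuousOn_iterate_of_forall_mapsTo hcont hf (Fin.last n))
      (mapsTo_iterate_of_forall_mapsTo hf (Fin.last n))
  have hzero : (0 : ℝ) ∈ uIcc (f^[n + 1] a - a) (f^[n + 1] b - b) := by
    rw [mem_uIcc_iff_mul_nonpos]
    linarith
  obtain ⟨x, hx, hfx⟩ := intermediate_value_uIcc (hI ▸ hiter.sub continuousOn_id) hzero
  exact ⟨x, sub_eq_zero.1 hfx, fun i => mapsTo_iterate_of_forall_mapsTo hf i (hI ▸ hx)⟩

end Iterate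

/-- The intervals with endpoints `a i` and `b i`, for `i = 0, …, n`, enclose a real cycle of length
`n + 1` of `z ↦ α z + β + γ / z`: each of them avoids `0` and the critical points and is mapped
into the next one, and the `n + 1`-st iterate minus the identity changes sign on the first. -/
structure IsCycleEnclosure {n : ℕ} (α β γ : ℝ) (a b : Fin (n + 1) → ℝ) : Prop where
  mul_pos : ∀ i, 0 < a i * b i
  deriv_mul_pos : ∀ i, 0 < (α - γ / a i ^ 2) * (α - γ / b i ^ 2)
  left_mem : ∀ i : Fin n, laurentFn α β γ (a i.castSucc) ∈ uIcc (a i.succ) (b i.succ)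
  right_mem : ∀ i : Fin n, laurentFn α β γ (b i.castSucc) ∈ uIcc (a i.succ) (b i.succ)
  iterate_mul_nonpos :
    ((laurentFn α β γ)^[n + 1] (a 0) - a 0) * ((laurentFn α β γ)^[n + 1] (b 0) - b 0) ≤ 0

lemma IsCycleEnclosure.exists_cycle {n : ℕ} {α β γ : ℝ} {a b : Fin (n + 1) → ℝ}
    (h : IsCycleEnclosure α β γ a b) :
    ∃ x, (laurentFn α β γ)^[n + 1] x = x ∧
      ∀ i : Fin (n + 1), (laurentFn α β γ)^[i] x ∈ uIcc (a i) (b i) := by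
  refine exists_iterate_eq_self_of_mul_nonpos (I := fun i => uIcc (a i) (b i)) rfl
    (fun i x hx => ?_) (fun i x hx => ?_) h.iterate_mul_nonpos
  · have hx₀ : x ≠ 0 := right_ne_zero_of_mul (mul_pos_of_mem_uIcc (h.mul_pos i) hx).1.ne'
    exact (hasDerivAt_laurentFn α β γ hx₀).continuousAt.continuousWithinAt
  · exact uIcc_subset_uIcc (h.left_mem i) (h.right_mem i)
      (laurentFn_mem_uIcc (h.mul_pos _) (h.deriv_mul_pos _) hx)

lemma iterate_laurentFn_ofReal (α β γ x : ℝ) (n : ℕ) :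
    (laurentFn (α : ℂ) β γ)^[n] x = ((laurentFn α β γ)^[n] x : ℝ) := by
  have hsemi : Function.Semiconj ((↑) : ℝ → ℂ) (laurentFn α β γ) (laurentFn (α : ℂ) β γ) :=
    fun y => by simp [laurentFn]
  exact ((hsemi.iterate_right n) x).symm

lemma IsCycleEnclosure.not_hasIntegerMultipliersUpTo {n N : ℕ} {α β γ : ℝ}
    {a b : Fin (n + 1) → ℝ} (h : IsCycleEnclosure α β γ a b)
    (hlower : N < ∏ i, min |α - γ / a i ^ 2| |α - γ / b i ^ 2|)
    (hupper : ∏ i, max |α - γ / a i ^ 2| |α - γ / b i ^ 2| < N + 1) :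
    ¬ HasIntegerMultipliersUpTo (n + 1) (QuadPair.laurent (α : ℂ) β γ).toMap := by
  intro hint
  obtain ⟨x, hcycle, hmem⟩ := h.exists_cycle
  have hne : ∀ i < n + 1, (laurentFn (α : ℂ) β γ)^[i] x ≠ 0 := by
    intro i hi
    rw [iterate_laurentFn_ofReal, Complex.ofReal_ne_zero]
    exact right_ne_zero_of_mul (mul_pos_of_mem_uIcc (h.mul_pos ⟨i, hi⟩) (hmem ⟨i, hi⟩)).1.ne'
  obtain ⟨k, hk⟩ := hint _ le_rfl _ _ (QuadPair.laurent_isFixedPtWithMultiplier_iterate hne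
    (by rw [iterate_laurentFn_ofReal, hcycle]))
  have hk' : |(k : ℝ)| = ∏ i : Fin (n + 1), |α - γ / ((laurentFn α β γ)^[i] x) ^ 2| := by
    rw [← Finset.abs_prod, ← Finset.prod_range fun i => α - γ / ((laurentFn α β γ)^[i] x) ^ 2]
    congr 1
    simp only [iterate_laurentFn_ofReal] at hk
    exact_mod_cast hk.symm
  have hderiv (i : Fin (n + 1)) : |α - γ / ((laurentFn α β γ)^[i] x) ^ 2| ∈
      uIcc |α - γ / a i ^ 2| |α - γ / b i ^ 2| := by
    have ⟨ha, hb⟩ := mul_ne_zero_iff.1 (h.mul_pos i).ne'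
    refine abs_mem_uIcc (h.deriv_mul_pos i)
      (sub_div_mem_uIcc α γ (by positivity) (by positivity) ?_)
    rw [sq ((laurentFn α β γ)^[i] x)]
    exact mul_mem_uIcc_sq (h.mul_pos i) (hmem i) (hmem i)
  have hgt : (N : ℝ) < |(k : ℝ)| := hlower.trans_le <| hk' ▸
    Finset.prod_le_prod (fun i _ => by positivity) fun i _ => (hderiv i).1
  have hlt : |(k : ℝ)| < N + 1 := hupper.trans_le' <| hk' ▸
    Finset.prod_le_prod (fun i _ => by positivity) fun i _ => (hderiv i).2
  have hgt' : (N : ℤ) < |k| := by exact_mod_cast hgt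
  have hlt' : |k| < (N : ℤ) + 1 := by exact_mod_cast hlt
  omega

end Enclosure

namespace QuadPair

lemma not_hasIntegerMultipliersUpTo_laurent_one_zero_neg_one :
    ¬ HasIntegerMultipliersUpTo 5 (laurent (1 : ℂ) 0 (-1)).toMap := by
  have h : IsCycleEnclosure 1 0 (-1)
      ![0.3602, -2.417, -2.004, -1.505, -0.841]
      ![0.3603, -2.415, -2, -1.5, -0.833] := by
    constructor <;> norm_num [Fin.forall_fin_succ, laurentFn, Set.mem_uIcc]
  simpa using h.not_hasIntegerMultipliersUpTo (N := 44)
    (by norm_num [Fin.prod_univ_succ]) (by norm_num [Fin.prod_univ_succ])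

lemma not_hasIntegerMultipliersUpTo_laurent_one_one_neg_one :
    ¬ HasIntegerMultipliersUpTo 5 (laurent (1 : ℂ) 1 (-1)).toMap := by
  have h : IsCycleEnclosure 1 1 (-1)
      ![0.1551, -5.293, -4.105, -2.862, -1.513]
      ![0.1552, -5.288, -4.098, -2.853, -1.502] := by
    constructor <;> norm_num [Fin.forall_fin_succ, laurentFn, Set.mem_uIcc]
  simpa using h.not_hasIntegerMultipliersUpTo (N := 75)
    (by norm_num [Fin.prod_univ_succ]) (by norm_num [Fin.prod_univ_succ])

lemma not_hasIntegerMultipliersUpTo_laurent_one_one_third :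
    ¬ HasIntegerMultipliersUpTo 5 (laurent (1 : ℂ) 1 3⁻¹).toMap := by
  have h : IsCycleEnclosure 1 1 3⁻¹
      ![-0.47124, -0.17861, -1.04519, -0.36422, -0.28058]
      ![-0.47123, -0.17858, -1.04484, -0.36376, -0.27895] := by
    constructor <;> norm_num [Fin.forall_fin_succ, laurentFn, Set.mem_uIcc]
  simpa using h.not_hasIntegerMultipliersUpTo (N := 16)
    (by norm_num [Fin.prod_univ_succ]) (by norm_num [Fin.prod_univ_succ])

lemma not_hasIntegerMultipliersUpTo_laurent_one_one_fourth :
    ¬ HasIntegerMultipliersUpTo 5 (laurent (1 : ℂ) 1 4⁻¹).toMap := by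
  have h : IsCycleEnclosure 1 1 4⁻¹
      ![-0.70191, -0.0581, -3.3685, -2.4429, -1.5456]
      ![-0.7019, -0.058, -3.3609, -2.4351, -1.5374] := by
    constructor <;> norm_num [Fin.forall_fin_succ, laurentFn, Set.mem_uIcc]
  simpa using h.not_hasIntegerMultipliersUpTo (N := 30)
    (by norm_num [Fin.prod_univ_succ]) (by norm_num [Fin.prod_univ_succ])

lemma not_hasIntegerMultipliersUpTo_laurent_neg_one_zero_two :
    ¬ HasIntegerMultipliersUpTo 5 (laurent (-1 : ℂ) 0 2).toMap := by
  have h : IsCycleEnclosure (-1) 0 2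
      ![-1.6756, 0.481, 3.667, -3.135, 2.48]
      ![-1.6755, 0.482, 3.678, -3.121, 2.498] := by
    constructor <;> norm_num [Fin.forall_fin_succ, laurentFn, Set.mem_uIcc]
  simpa using h.not_hasIntegerMultipliersUpTo (N := 30)
    (by norm_num [Fin.prod_univ_succ]) (by norm_num [Fin.prod_univ_succ])

lemma not_hasIntegerMultipliersUpTo_laurent_neg_one_neg_two_four :
    ¬ HasIntegerMultipliersUpTo 5 (laurent (-1 : ℂ) (-2) 4).toMap := by
  have h : IsCycleEnclosure (-1) (-2) 4
      ![-3.656, 0.56, 4.555, -5.711, 2.971]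
      ![-3.655, 0.562, 4.583, -5.676, 3.011] := by
    constructor <;> norm_num [Fin.forall_fin_succ, laurentFn, Set.mem_uIcc]
  simpa using h.not_hasIntegerMultipliersUpTo (N := 34)
    (by norm_num [Fin.prod_univ_succ]) (by norm_num [Fin.prod_univ_succ])

end QuadPair

/-! ### Multipliers at the fixed points -/

namespace QuadPair

lemma ratMap_X_sq : ratMap (X ^ 2) 1 = (poly 0).toMap := by
  rw [ratMap_eq_toMap (by simp)]
  simp [ofPolynomials, poly, coeff_X_pow, coeff_one]

lemma ratMap_one_X_sq : ratMap 1 (X ^ 2) = toMap ⟨0, 0, 1, 1, 0, 0⟩ := by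
  rw [ratMap_eq_toMap (by simp)]
  simp [ofPolynomials, coeff_X_pow, coeff_one]

lemma ratMap_chebyshev_two : ratMap (Chebyshev.C ℂ (2 : ℕ)) 1 = (poly (-2)).toMap := by
  have hC : Chebyshev.C ℂ (2 : ℕ) = X ^ 2 - Polynomial.C 2 := by
    rw [Nat.cast_ofNat, Chebyshev.C_two, map_ofNat]
  rw [hC, ratMap_eq_toMap (by rw [natDegree_X_pow_sub_C]; simp)]
  simp [ofPolynomials, poly, coeff_X_pow, coeff_one, coeff_C]

lemma poly_isFixedPtWithMultiplier {c z : ℂ} (hz : z ^ 2 + c = z) :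
    IsFixedPtWithMultiplier (poly c).toMap z (2 * z) := by
  simpa using poly_isFixedPtWithMultiplier_iterate (n := 1) (by simpa using hz)

lemma eq_zero_or_eq_neg_two_of_hasIntegerMultipliersUpTo_poly {c : ℂ}
    (h : HasIntegerMultipliersUpTo 3 (poly c).toMap) : c = 0 ∨ c = -2 := by
  obtain ⟨z, hz⟩ := exists_quadratic_root (-1) c
  obtain ⟨k, hk⟩ := h.exists_int (by norm_num)
    (poly_isFixedPtWithMultiplier (c := c) (z := z) (by linear_combination hz))
  have hc : 4 * c = 1 - ((1 - k : ℤ) : ℂ) ^ 2 := by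
    push_cast
    rw [← hk]
    linear_combination 4 * hz
  rcases sq_eq_of_hasIntegerMultipliersUpTo_poly hc h with hsq | hsq <;>
    rw [← Int.cast_pow, hsq] at hc <;> push_cast at hc
  · exact .inl (by linear_combination hc / 4)
  · exact .inr (by linear_combination hc / 4)

lemma not_hasIntegerMultipliersUpTo_laurent_one_one {γ : ℂ} (hγ : γ ≠ 0) :
    ¬ HasIntegerMultipliersUpTo 5 (laurent 1 1 γ).toMap := by
  intro h
  have hfix : laurentFn 1 1 γ (-γ) = -γ :=
    (laurentFn_eq_iff (neg_ne_zero.2 hγ)).2 (by ring)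
  obtain ⟨n, hn⟩ := h.exists_int (by norm_num)
    (laurent_isFixedPtWithMultiplier (neg_ne_zero.2 hγ) hfix)
  have hγn : γ = ((1 - n : ℤ) : ℂ)⁻¹ := by
    push_cast
    rw [← hn]
    field_simp
    ring
  have hn₀ : 1 - n ≠ 0 := by
    rintro hn₀
    simp [hn₀, hγ] at hγn
  rw [hγn] at h
  rcases eq_of_hasIntegerMultipliersUpTo_laurent hn₀ (h.mono (by norm_num)) with
    hn | hn | hn <;> rw [hn] at h
  · exact not_hasIntegerMultipliersUpTo_laurent_one_one_neg_one (by norm_num at h; exact h)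
  · exact not_hasIntegerMultipliersUpTo_laurent_one_one_third (by exact_mod_cast h)
  · exact not_hasIntegerMultipliersUpTo_laurent_one_one_fourth (by exact_mod_cast h)

lemma not_hasIntegerMultipliersUpTo_laurent_one {β γ : ℂ} (hγ : γ ≠ 0) :
    ¬ HasIntegerMultipliersUpTo 5 (laurent 1 β γ).toMap := by
  intro h
  have scaled {t : ℂ} (ht : t ≠ 0) :
      HasIntegerMultipliersUpTo 5 (laurent 1 (t * β) (t ^ 2 * γ)).toMap :=
    h.of_areMoebiusConjugate ((isLinearConj_laurent_scale 1 β γ ht).areMoebiusConjugate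
      (laurent_nondeg one_ne_zero hγ))
  rcases eq_or_ne β 0 with rfl | hβ
  · obtain ⟨t, ht⟩ := exists_quadratic_root 0 γ⁻¹
    have htγ : t ^ 2 * γ = -1 := by
      field_simp at ht
      linear_combination ht
    have ht₀ : t ≠ 0 := by
      rintro rfl
      simp at htγ
    have h' := scaled ht₀
    rw [mul_zero, htγ] at h'
    exact not_hasIntegerMultipliersUpTo_laurent_one_zero_neg_one h'
  · have h' := scaled (inv_ne_zero hβ)
    rw [inv_mul_cancel₀ hβ] at h'
    exact not_hasIntegerMultipliersUpTo_laurent_one_one (by simp [hβ, hγ]) h'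

section

variable {F : QuadPair ℂ} {x : OnePoint ℂ}

lemma Nondeg.conj_poly_of_multiplier_zero (hF : F.Nondeg)
    (h : HasIntegerMultipliersUpTo 3 F.toMap) (hx : IsFixedPtWithMultiplier F.toMap x 0) :
    AreMoebiusConjugate F.toMap (poly 0).toMap ∨ AreMoebiusConjugate F.toMap (poly (-2)).toMap := by
  obtain ⟨c, hc⟩ := hF.exists_conj_poly hx
  rcases eq_zero_or_eq_neg_two_of_hasIntegerMultipliersUpTo_poly
    (h.of_areMoebiusConjugate hc) with rfl | rfl
  exacts [.inl hc, .inr hc]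

lemma Nondeg.multiplier_ne_one (hF : F.Nondeg) (h : HasIntegerMultipliersUpTo 5 F.toMap)
    (x : OnePoint ℂ) : ¬ IsFixedPtWithMultiplier F.toMap x 1 := by
  intro hx
  obtain ⟨β, γ, hγ, hconj⟩ := hF.exists_conj_laurent hx one_ne_zero
  rw [inv_one] at hconj
  exact not_hasIntegerMultipliersUpTo_laurent_one hγ (h.of_areMoebiusConjugate hconj)

lemma Nondeg.exists_conj_fixedForm (hF : F.Nondeg) (h : HasIntegerMultipliersUpTo 1 F.toMap)
    (h₀ : ∀ y, ¬ IsFixedPtWithMultiplier F.toMap y 0)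
    (h₁ : ∀ y, ¬ IsFixedPtWithMultiplier F.toMap y 1) {a : ℤ}
    (hx : IsFixedPtWithMultiplier F.toMap x (1 - a)) :
    ∃ (b c : ℤ) (r : ℂ), (b : ℂ) = (1 - (1 - (a : ℂ))⁻¹) * (1 - r) ∧
      (a : ℚ)⁻¹ + (b : ℚ)⁻¹ + (c : ℚ)⁻¹ = 1 ∧
      (∃ y, IsFixedPtWithMultiplier F.toMap y (1 - b)) ∧
      (∃ y, IsFixedPtWithMultiplier F.toMap y (1 - c)) ∧
      AreMoebiusConjugate F.toMap (fixedForm (1 - (a : ℂ))⁻¹ r).toMap := by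
  have hm₀ : 1 - (a : ℂ) ≠ 0 := fun hm => h₀ x (hm ▸ hx)
  have hm₁ : 1 - (a : ℂ) ≠ 1 := fun hm => h₁ x (hm ▸ hx)
  obtain ⟨β, γ, hγ, hlaurent⟩ := hF.exists_conj_laurent hx hm₀
  obtain ⟨r, hr₀, hfixed⟩ :=
    exists_laurent_conj_fixedForm (β := β) (inv_ne_zero hm₀) (inv_eq_one.not.2 hm₁) hγ
  have hconj := hlaurent.trans hfixed
  obtain ⟨y, hy⟩ :=
    hconj.symm.exists_isFixedPtWithMultiplier (fixedForm_isFixedPtWithMultiplier_one _ r)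
  obtain ⟨z, hz⟩ :=
    hconj.symm.exists_isFixedPtWithMultiplier (fixedForm_isFixedPtWithMultiplier_right _ hr₀)
  have hr₁ : r ≠ 1 := by
    rintro rfl
    exact h₁ y (by simpa using hy)
  have hsum := fixedForm_sum_inv (inv_ne_zero hm₀) (inv_eq_one.not.2 hm₁) hr₀ hr₁
  obtain ⟨k, hk⟩ := h.exists_int le_rfl hy
  obtain ⟨l, hl⟩ := h.exists_int le_rfl hz
  have hb : ((1 - k : ℤ) : ℂ) = (1 - (1 - (a : ℂ))⁻¹) * (1 - r) := by
    push_cast; linear_combination hk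
  have hc : ((1 - l : ℤ) : ℂ) = (1 - (1 - (a : ℂ))⁻¹) * (1 - r⁻¹) := by
    push_cast; linear_combination hl
  rw [inv_inv, sub_sub_cancel, ← hb, ← hc] at hsum
  rw [← hb] at hy
  rw [← hc] at hz
  have hsum' : (a : ℚ)⁻¹ + ((1 - k : ℤ) : ℚ)⁻¹ + ((1 - l : ℤ) : ℚ)⁻¹ = 1 := by
    rw [← Rat.cast_inj (α := ℂ)]
    simpa using hsum
  exact ⟨1 - k, 1 - l, r, hb, hsum', ⟨y, hy⟩, ⟨z, hz⟩, hconj⟩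

lemma Nondeg.multiplier_ne_neg_one (hF : F.Nondeg) (h : HasIntegerMultipliersUpTo 5 F.toMap)
    (h₀ : ∀ y, ¬ IsFixedPtWithMultiplier F.toMap y 0) (x : OnePoint ℂ) :
    ¬ IsFixedPtWithMultiplier F.toMap x (-1) := by
  intro hx
  have h₁ := hF.multiplier_ne_one h
  obtain ⟨b, c, r, hr, hsum, ⟨y, hy⟩, ⟨z, hz⟩, hconj⟩ :=
    hF.exists_conj_fixedForm (h.mono (by norm_num)) h₀ h₁ (x := x) (a := 2) (by norm_num; exact hx)
  have hne {n : ℤ} {y : OnePoint ℂ} (hy : IsFixedPtWithMultiplier F.toMap y (1 - n)) :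
      n ≠ 0 ∧ n ≠ 1 := by
    constructor <;> rintro rfl
    exacts [h₁ y (by simpa using hy), h₀ y (by simpa using hy)]
  have hα : (1 - ((2 : ℤ) : ℂ))⁻¹ = -1 := by norm_num
  rw [hα] at hr hconj
  have hint := h.of_areMoebiusConjugate hconj
  have hr' : r = 1 - b / 2 := by linear_combination hr / 2
  rcases eq_of_inv_add_inv_eq_half (hne hy).1 (hne hy).2 (hne hz).1 (hne hz).2
    (by push_cast at hsum; linear_combination hsum) with rfl | rfl | rfl
  · have hscale := isLinearConj_laurent_scale (-1) 1 1 (neg_ne_zero.2 (two_ne_zero (α := ℂ)))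
    have hconj' := hscale.areMoebiusConjugate (laurent_nondeg (by norm_num) one_ne_zero)
    norm_num [hr', fixedForm] at hint hconj'
    exact not_hasIntegerMultipliersUpTo_laurent_neg_one_neg_two_four
      (hint.of_areMoebiusConjugate hconj')
  · norm_num [hr', fixedForm] at hint
    exact not_hasIntegerMultipliersUpTo_laurent_neg_one_zero_two hint
  · norm_num [hr', fixedForm] at hint
    exact not_hasIntegerMultipliersUpTo_laurent_neg_one_neg_two_four hint

lemma conj_inv_sq_of_fixedForm :
    AreMoebiusConjugate (fixedForm (-1 / 2) (-1)).toMap (toMap ⟨0, 0, 1, 1, 0, 0⟩) := by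
  obtain ⟨s, hs⟩ := exists_quadratic_root (0 : ℂ) 3
  have hs₀ : s ≠ 0 := by
    rintro rfl
    norm_num at hs
  have hlin : IsLinearConj (fixedForm (-1 / 2) (-1)) ⟨0, 0, 1, 1, 0, 0⟩ 1 (-s) 1 s (-1 / 2) := by
    refine ⟨fun h => hs₀ (by linear_combination h / 2), by norm_num, fun x y => ?_, fun x y => ?_⟩
      <;> simp only [fixedForm, laurent, num, den] <;> linear_combination y ^ 2 / 2 * hs
  exact hlin.areMoebiusConjugate (laurent_nondeg (by norm_num) (by norm_num))

lemma Nondeg.conj_inv_sq (hF : F.Nondeg) (h : HasIntegerMultipliersUpTo 5 F.toMap)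
    (h₀ : ∀ y, ¬ IsFixedPtWithMultiplier F.toMap y 0) :
    AreMoebiusConjugate F.toMap (toMap ⟨0, 0, 1, 1, 0, 0⟩) := by
  have h₁ := hF.multiplier_ne_one h
  have h₂ := hF.multiplier_ne_neg_one h h₀
  have houtside {n : ℤ} {y : OnePoint ℂ} (hy : IsFixedPtWithMultiplier F.toMap y (1 - n)) :
      n < 0 ∨ 2 < n := by
    by_contra! hn
    obtain ⟨hn₀, hn₂⟩ := hn
    interval_cases n
    exacts [h₁ y (by simpa using hy), h₀ y (by simpa using hy), h₂ y (by norm_num at hy; exact hy)]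
  obtain ⟨x, hx⟩ := hF.exists_fixedPt
  obtain ⟨m, hm⟩ := hF.exists_hasSphereDeriv x
  obtain ⟨k, rfl⟩ := h.exists_int (by norm_num) ⟨hx, hm⟩
  have hxa : IsFixedPtWithMultiplier F.toMap x (1 - (1 - k : ℤ)) := by
    push_cast
    rw [sub_sub_cancel]
    exact ⟨hx, hm⟩
  obtain ⟨b, c, r, hr, hsum, ⟨y, hy⟩, ⟨z, hz⟩, hconj⟩ :=
    hF.exists_conj_fixedForm (h.mono (by norm_num)) h₀ h₁ hxa
  obtain ⟨ha, rfl⟩ :=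
    eq_three_of_sum_inv_eq_one (houtside hxa) (houtside hy) (houtside hz) hsum
  have hα : (1 - ((3 : ℤ) : ℂ))⁻¹ = -1 / 2 := by norm_num
  rw [ha, hα] at hr hconj
  have hr' : r = -1 := by
    push_cast at hr
    linear_combination 2 / 3 * hr
  exact hconj.trans (hr' ▸ conj_inv_sq_of_fixedForm)

end

end QuadPair

theorem mainTheorem2_general (f : OnePoint ℂ → OnePoint ℂ) (hf : IsRationalMap 2 f)
    (hmult : ∀ x μ, Function.minimalPeriod f x ≤ 5 → HasMultiplierAt f x μ → ∃ m : ℤ, μ = m) :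
    IsPowerMap f ∨ IsChebyshevMap f := by
  obtain ⟨F, hF, rfl⟩ : ∃ F : QuadPair ℂ, F.Nondeg ∧ f = F.toMap := by
    obtain ⟨p, q, hpq, hdeg, rfl⟩ := hf
    exact ⟨_, QuadPair.nondeg_ofPolynomials hpq hdeg, QuadPair.ratMap_eq_toMap hdeg⟩
  have hint : HasIntegerMultipliersUpTo 5 F.toMap :=
    hasIntegerMultipliersUpTo_of_minimalPeriod_le hF.exists_hasSphereDeriv hmult
  by_cases hzero : ∃ x, IsFixedPtWithMultiplier F.toMap x 0
  · obtain ⟨x, hx⟩ := hzero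
    rcases hF.conj_poly_of_multiplier_zero (hint.mono (by norm_num)) hx with hconj | hconj
    · exact .inl ⟨2, le_rfl, hf, .inl (QuadPair.ratMap_X_sq ▸ hconj)⟩
    · exact .inr ⟨2, le_rfl, hf, .inl (QuadPair.ratMap_chebyshev_two ▸ hconj)⟩
  · have hconj := hF.conj_inv_sq hint (not_exists.1 hzero)
    exact .inl ⟨2, le_rfl, hf, .inr (QuadPair.ratMap_one_X_sq ▸ hconj)⟩

theorem mainTheorem2 (f : OnePoint ℂ → OnePoint ℂ) (hf : IsRationalMap 2 f)
    (hmult : HasOnlyIntegerMultipliers f) : IsPowerMap f ∨ IsChebyshevMap f :=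
  mainTheorem2_general f hf fun x μ _ => hmult x μ
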